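/- Conventions. Let $\mathbb D$, $\mathbb T$, $\mathbb E$ be the open unit disk, the unit circle, and the complement of the closed unit disk in $\mathbb C$. A pure isometry on a complex Hilbert space $\mathcal H$ is an isometry $S$ with $\bigcap_{n} S^n\mathcal H=\{0\}$; its multiplicity is $\dim\ker S^*$. For a nonzero $p\in\mathbb C[z,w]$, a pure $p$-isopair is a pair $V=(S,T)$ of commuting pure isometries on a Hilbert space $\mathcal H$ with $p(S,T)=0$; it has finite bimultiplicity if $S$ and $T$ have finite multiplicity. For vectors $f_1,\dots,f_k\in\mathcal H$ let $[f_1,\dots,f_k]_V$ be the closure of $\{\sum_{j} q_j(S,T)f_j : q_j\in\mathbb C[z,w]\}$. The pair $V$ is $k$-cyclic if $[f_1,\dots,f_k]_V=\mathcal H$ for some choice of $k$ vectors and this holds for no choice of fewer than $k$ vectors; it is nearly $k$-cyclic if $[f_1,\dots,f_k]_V$ has finite codimension in $\mathcal H$ for some choice of $k$ vectors and for no choice of fewer than $k$ vectors; it is at most nearly $k$-cyclic if it is nearly $l$-cyclic for some $l\le k$. A polynomial $p\in\mathbb C[z,w]$ with zero set $Z(p)\subset\mathbb C^2$ is inner toral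 if $Z(p)\subset\mathbb D^2\cup\mathbb T^2\cup\mathbb E^2$. If $p$ is irreducible and inner toral, a pure $p$-isopair $(S,T)$ of finite bimultiplicity has rank $\alpha$ if $\dim\bigl(\ker(S-\lambda)^*\cap\ker(T-\mu)^*\bigr)=\alpha$ for every $(\lambda,\mu)\in Z(p)\cap\mathbb D^2$ with $\nabla p(\lambda,\mu)\neq 0$. (1) Suppose $p_1,p_2\in\mathbb C[z,w]$ are relatively prime (they need not be irreducible), and for $j=1,2$ let $V_j=(S_j,T_j)$ be a $\beta_j$-cyclic pure $p_j$-isopair. Then $V_1\oplus V_2$ is at most nearly $\max\{\beta_1,\beta_2\}$-cyclic. (2) Let $\mathfrak p=\mathfrak p_1\mathfrak p_2\cdots\mathfrak p_s$ be a square free inner toral polynomial with irreducible factors $\mathfrak p_j$. For $1\le j\le s$ let $V_j=(S_j,T_j)$ be a pure $\mathfrak p_j$-isopair of finite bimultiplicity and rank $\alpha_j$ on a Hilbert space $\mathcal K_j$. Then $\bigoplus_{j=1}^s V_j$ is nearly $\max\{\alpha_1,\dots,\alpha_s\}$-cyclic on $\bigoplus_{j=1}^s\mathcal K_j$. -/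

import Mathlib

namespace Isopair

open ContinuousLinearMap Cardinal

noncomputable section

/-- Polynomials in two variables `z` (index `0`) and `w` (index `1`) over the complex numbers. -/
abbrev Poly : Type := MvPolynomial (Fin 2) ℂ

/-- The zero set `Z(p)` in `ℂ²`. -/
def zeroSet (p : Poly) : Set (ℂ × ℂ) := {x | MvPolynomial.eval ![x.1, x.2] p = 0}

/-- `p` is inner toral: `Z(p)` is contained in `𝔻² ∪ 𝕋² ∪ 𝔼²`, where `𝔻` is the open unit disk,
`𝕋` the unit circle and `𝔼` the complement of the closed unit disk. -/
def IsInnerToral (p : Poly) : Prop :=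
  ∀ x ∈ zeroSet p, (‖x.1‖ < 1 ∧ ‖x.2‖ < 1) ∨ (‖x.1‖ = 1 ∧ ‖x.2‖ = 1) ∨ (1 < ‖x.1‖ ∧ 1 < ‖x.2‖)

/-- `𝔙(p) = Z(p) ∩ 𝔻²`. -/
def diskVariety (p : Poly) : Set (ℂ × ℂ) := {x | x ∈ zeroSet p ∧ ‖x.1‖ < 1 ∧ ‖x.2‖ < 1}

/-- `x` is a regular point for `p`: `p` vanishes at `x` and its gradient does not. -/
def IsRegularPoint (p : Poly) (x : ℂ × ℂ) : Prop :=
  x ∈ zeroSet p ∧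
    (MvPolynomial.eval ![x.1, x.2] (MvPolynomial.pderiv 0 p) ≠ 0 ∨
      MvPolynomial.eval ![x.1, x.2] (MvPolynomial.pderiv 1 p) ≠ 0)

section Operators

variable {H : Type*} [NormedAddCommGroup H] [InnerProductSpace ℂ H]

/-- `q(S,T) = ∑ c_{ab} S^a T^b` for `q = ∑ c_{ab} z^a w^b`, as a linear map in `q`. It is only
used for commuting `S` and `T`. -/
def polyEval (S T : H →L[ℂ] H) : Poly →ₗ[ℂ] (H →L[ℂ] H) :=
  (MvPolynomial.basisMonomials (Fin 2) ℂ).constr ℂ fun m => S ^ m 0 * T ^ m 1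

/-- The explicit formula for `q(S,T)`. -/
theorem polyEval_apply (S T : H →L[ℂ] H) (q : Poly) :
    polyEval S T q = ∑ m ∈ q.support, q.coeff m • (S ^ m 0 * T ^ m 1) := by
  rw [polyEval, Module.Basis.constr_apply]
  rfl

/-- The linear span `{∑ⱼ qⱼ(S,T) fⱼ : qⱼ ∈ ℂ[z,w]}` generated by the vectors `f₁, …, f_k`. -/
def polySpan (S T : H →L[ℂ] H) {k : ℕ} (f : Fin k → H) : Submodule ℂ H where
  carrier := {x | ∃ q : Fin k → Poly, x = ∑ j, polyEval S T (q j) (f j)}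
  add_mem' := by
    rintro _ _ ⟨q, rfl⟩ ⟨r, rfl⟩
    exact ⟨q + r, by simp [Finset.sum_add_distrib]⟩
  zero_mem' := ⟨0, by simp⟩
  smul_mem' := by
    rintro c _ ⟨q, rfl⟩
    exact ⟨c • q, by simp [Finset.smul_sum]⟩

/-- Some `k` vectors generate a dense subspace. -/
def HasCyclicVectors (S T : H →L[ℂ] H) (k : ℕ) : Prop :=
  ∃ f : Fin k → H, (polySpan S T f).topologicalClosure = ⊤

/-- Some `k` vectors generate a subspace whose closure has finite codimension. -/
def HasNearlyCyclicVectors (S T : H →L[ℂ] H) (k : ℕ) : Prop :=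
  ∃ f : Fin k → H, FiniteDimensional ℂ (H ⧸ (polySpan S T f).topologicalClosure)

/-- `(S,T)` is `k`-cyclic: `k` vectors generate a dense subspace, and no fewer do. -/
def IsCyclic (S T : H →L[ℂ] H) (k : ℕ) : Prop :=
  HasCyclicVectors S T k ∧ ∀ l < k, ¬ HasCyclicVectors S T l

/-- `(S,T)` is nearly `k`-cyclic: `k` vectors generate a subspace with closure of finite
codimension, and no fewer do. -/
def IsNearlyCyclic (S T : H →L[ℂ] H) (k : ℕ) : Prop :=
  HasNearlyCyclicVectors S T k ∧ ∀ l < k, ¬ HasNearlyCyclicVectors S T l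

/-- `(S,T)` is at most nearly `k`-cyclic: it is nearly `l`-cyclic for some `l ≤ k`. -/
def IsAtMostNearlyCyclic (S T : H →L[ℂ] H) (k : ℕ) : Prop :=
  ∃ l ≤ k, IsNearlyCyclic S T l

/-- A pure isometry: an isometry `V` whose unitary part `⋂ₙ Vⁿ H` in the Wold decomposition
is zero. -/
def IsPureIsometry (V : H →L[ℂ] H) : Prop :=
  Isometry V ∧ (⋂ n : ℕ, Set.range (V ^ n)) = {0}

/-- `(S,T)` is a pure `p`-isopair: a commuting pair of pure isometries annihilated by the
nonzero polynomial `p`. -/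
structure IsPureIsopair (p : Poly) (S T : H →L[ℂ] H) : Prop where
  ne_zero : p ≠ 0
  commute : Commute S T
  pure_left : IsPureIsometry S
  pure_right : IsPureIsometry T
  annihilates : polyEval S T p = 0

variable [CompleteSpace H]

/-- The multiplicity `dim ker V*` of an isometry. -/
def mult (V : H →L[ℂ] H) : Cardinal :=
  Module.rank ℂ (LinearMap.ker (adjoint V : H →L[ℂ] H).toLinearMap)

/-- Both entries of the bimultiplicity `(mult S, mult T)` are finite. -/
def FiniteBimultiplicity (S T : H →L[ℂ] H) : Prop :=
  mult S < ℵ₀ ∧ mult T < ℵ₀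

/-- The joint eigenspace `ker (S - λ)* ∩ ker (T - μ)*`, where `x = (λ, μ)`. -/
def jointKer (S T : H →L[ℂ] H) (x : ℂ × ℂ) : Submodule ℂ H :=
  LinearMap.ker (adjoint (S - x.1 • (1 : H →L[ℂ] H)) : H →L[ℂ] H).toLinearMap ⊓
    LinearMap.ker (adjoint (T - x.2 • (1 : H →L[ℂ] H)) : H →L[ℂ] H).toLinearMap

/-- For an irreducible inner toral `p`, the pure `p`-isopair `(S,T)` of finite bimultiplicity has
rank `a`: the space `ker (S - λ)* ∩ ker (T - μ)*` has dimension `a` at every point `(λ, μ)` of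
`𝔙(p)` that is regular for `p`. For such `p` all but finitely many of the infinitely many points
of `𝔙(p)` are regular, so `a` is determined. -/
def HasRank (p : Poly) (S T : H →L[ℂ] H) (a : ℕ) : Prop :=
  ∀ x ∈ diskVariety p, IsRegularPoint p x → Module.rank ℂ (jointKer S T x) = a

end Operators

/-- The direct sum `⨁ⱼ Aⱼ` of operators on the Hilbert space direct sum `⨁ⱼ Kⱼ`. -/
def directSum {ι : Type*} [Fintype ι] {K : ι → Type*} [∀ j, NormedAddCommGroup (K j)]
    [∀ j, InnerProductSpace ℂ (K j)] (A : ∀ j, K j →L[ℂ] K j) : PiLp 2 K →L[ℂ] PiLp 2 K :=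
  ((PiLp.continuousLinearEquiv 2 ℂ K).symm : (∀ j, K j) →L[ℂ] PiLp 2 K) ∘L
    ContinuousLinearMap.pi (fun j => A j ∘L ContinuousLinearMap.proj j) ∘L
      ((PiLp.continuousLinearEquiv 2 ℂ K) : PiLp 2 K →L[ℂ] (∀ j, K j))

theorem directSum_apply {ι : Type*} [Fintype ι] {K : ι → Type*} [∀ j, NormedAddCommGroup (K j)]
    [∀ j, InnerProductSpace ℂ (K j)] (A : ∀ j, K j →L[ℂ] K j) (x : PiLp 2 K) (j : ι) :
    directSum A x j = A j (x j) :=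
  rfl

end

end Isopair

/-! The upper bounds rest on one finiteness fact: if `p` and `g` are relatively prime, then
`ℂ[z,w]/(p,g)` is finite dimensional. Hence, for a pair annihilated by `p`, replacing generators by
their `g`-multiples costs only finite codimension (`finiteDimensional_quotient_of_mul_mem`). In a
direct sum, multiplication by the product of the other `p i` kills all summands but one, so
generators of the summands can be merged coordinatewise into the same number of vectors
(`hasNearlyCyclicVectors_directSum`). This gives (1), and reduces the upper bound in (2) to one
summand of rank `r`.

For one summand, let `n` be the degree of `p` in `z`. Over a generic `b` in the disk, `p(·, b)` has
`n` simple zeros, all in the disk, and each carries a joint eigenspace of dimension `r`; hence `dim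
ker T* ≤ n * r` (`mult_le_of_hasRank`). A basis of `ker T*` generates a dense subspace, and its
`ℂ[w]`-span is stable under `S` up to torsion. A maximal subfamily independent modulo `p` then has
at most `dim ker T* / n ≤ r` members, and a multiplier prime to `p` sends the whole basis into its
span (`exists_subset_generators`). So `r` vectors nearly generate
(`hasNearlyCyclicVectors_of_hasRank`).

For the lower bound, joint eigenvectors act as point evaluations. At a generic point none of them is
orthogonal to an invariant subspace of finite codimension, so pairing with its `l` generators embeds
an `r`-dimensional space in `ℂ^l` (`HasRank.le_of_hasNearlyCyclicVectors`). Near cyclicity passes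
from the sum to each summand by projection. -/

namespace Isopair

open ContinuousLinearMap Cardinal

noncomputable section

/-! ### Elimination theory in `ℂ[z,w]`. -/

open Polynomial in
/-- Relatively prime polynomials over a unique factorization domain have a nonzero constant in the
ideal they generate. -/
theorem exists_ne_zero_C_mem_span_pair {D : Type*} [CommRing D] [IsDomain D]
    [NormalizedGCDMonoid D] {p g : D[X]} (h : IsRelPrime p g) :
    ∃ a : D, a ≠ 0 ∧ C a ∈ Ideal.span {p, g} := by
  classical
  let K := FractionRing D
  have hinj : Function.Injective (algebraMap D K) := IsFractionRing.injective D K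
  by_cases hc : IsCoprime (p.map (algebraMap D K)) (g.map (algebraMap D K))
  · obtain ⟨u, v, huv⟩ := hc
    obtain ⟨c, c0, hcu⟩ := IsLocalization.integerNormalization_spec (nonZeroDivisors D) u
    obtain ⟨d, d0, hdv⟩ := IsLocalization.integerNormalization_spec (nonZeroDivisors D) v
    set U := IsLocalization.integerNormalization (nonZeroDivisors D) u
    set V := IsLocalization.integerNormalization (nonZeroDivisors D) v
    -- Clear the denominators `c`, `d` of the two Bézout coefficients over the fraction field.
    refine ⟨c * d, mul_ne_zero (nonZeroDivisors.ne_zero c0) (nonZeroDivisors.ne_zero d0), ?_⟩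
    rw [Ideal.mem_span_pair]
    refine ⟨C d * U, C c * V, ?_⟩
    apply Polynomial.map_injective _ hinj
    rw [Algebra.smul_def, Polynomial.algebraMap_apply] at hcu hdv
    simp only [Polynomial.map_add, Polynomial.map_mul, Polynomial.map_C, hcu, hdv, map_mul]
    linear_combination (C (algebraMap D K c) * C (algebraMap D K d)) * huv
  -- Gauss's lemma: a nontrivial gcd over the fraction field has, after clearing denominators, a
  -- primitive part dividing `p` and `g` over `D`. Relative primality makes that part a unit, so the
  -- gcd is constant.
  · exfalso
    have hpg : ¬ (p = 0 ∧ g = 0) := by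
      rintro ⟨rfl, rfl⟩
      exact not_isUnit_zero (isRelPrime_self.1 h)
    set q := gcd (p.map (algebraMap D K)) (g.map (algebraMap D K)) with hq
    have hqu : ¬ IsUnit q := fun hu => hc ((gcd_isUnit_iff _ _).1 hu)
    have hq0 : q ≠ 0 := by
      intro h0
      rw [hq, gcd_eq_zero_iff, Polynomial.map_eq_zero_iff hinj,
        Polynomial.map_eq_zero_iff hinj] at h0
      exact hpg h0
    obtain ⟨c, c0, hcq⟩ := IsLocalization.integerNormalization_spec (nonZeroDivisors D) q
    set Q := IsLocalization.integerNormalization (nonZeroDivisors D) q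
    rw [Algebra.smul_def, Polynomial.algebraMap_apply] at hcq
    have hcK : algebraMap D K c ≠ 0 := by
      simpa using (map_ne_zero_iff _ hinj).2 (nonZeroDivisors.ne_zero c0)
    have hQ0 : Q ≠ 0 := by
      rintro h0
      rw [h0, Polynomial.map_zero] at hcq
      exact mul_ne_zero (C_ne_zero.2 hcK) hq0 hcq.symm
    have hmul : Q.primPart.map (algebraMap D K) ∣ q := by
      have h1 : Q.primPart.map (algebraMap D K) ∣ C (algebraMap D K c) * q := by
        rw [← hcq]
        exact Polynomial.map_dvd _ (primPart_dvd Q)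
      exact (isUnit_C.2 hcK.isUnit).dvd_mul_left.1 h1
    have hd1 := Q.isPrimitive_primPart.dvd_of_fraction_map_dvd_fraction_map (K := K)
      (hmul.trans (gcd_dvd_left _ _))
    have hd2 := Q.isPrimitive_primPart.dvd_of_fraction_map_dvd_fraction_map (K := K)
      (hmul.trans (gcd_dvd_right _ _))
    have hu := h hd1 hd2
    have hdeg : q.natDegree = 0 := by
      have := congrArg natDegree hcq
      rw [natDegree_map_eq_of_injective hinj, natDegree_C_mul hcK, ← natDegree_primPart,
        natDegree_eq_zero_of_isUnit hu] at this
      exact this.symm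
    exact hqu (Polynomial.isUnit_iff_degree_eq_zero.2
      (by rw [degree_eq_natDegree hq0, hdeg]; rfl))

open Polynomial in
/-- `ℂ[z,w]` as polynomials in `z` with coefficients in `ℂ[w]`. -/
def bivariate : Poly ≃ₐ[ℂ] ℂ[X][X] :=
  (MvPolynomial.finSuccEquiv ℂ 1).trans
    (Polynomial.mapAlgEquiv (MvPolynomial.uniqueAlgEquiv ℂ (Fin 1)))

@[simp] theorem bivariate_X_zero : bivariate (MvPolynomial.X 0) = Polynomial.X := by
  simp [bivariate, MvPolynomial.finSuccEquiv_X_zero]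

@[simp] theorem bivariate_X_one :
    bivariate (MvPolynomial.X 1) = Polynomial.C Polynomial.X := by
  have h := MvPolynomial.finSuccEquiv_X_succ (R := ℂ) (n := 1) (j := 0)
  rw [show Fin.succ (0 : Fin 1) = 1 from rfl] at h
  simp [bivariate, h, MvPolynomial.uniqueAlgEquiv]

theorem bivariate_C (c : ℂ) :
    bivariate (MvPolynomial.C c) = Polynomial.C (Polynomial.C c) :=
  bivariate.commutes c

open Polynomial in
theorem eval_eq_eval_map_bivariate (a b : ℂ) (p : Poly) :
    MvPolynomial.eval ![a, b] p = ((bivariate p).map (evalRingHom b)).eval a := by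
  induction p using MvPolynomial.induction_on with
  | C c => simp [bivariate_C]
  | add p q hp hq => simp [hp, hq]
  | mul_X p i hp => fin_cases i <;> simp [hp]

open Polynomial in
theorem bivariate_pderiv_zero (p : Poly) :
    bivariate (MvPolynomial.pderiv 0 p) = derivative (bivariate p) := by
  induction p using MvPolynomial.induction_on with
  | C c => simp [bivariate_C]
  | add p q hp hq => simp [hp, hq]
  | mul_X p i hp =>
    fin_cases i <;> simp [hp, Derivation.leibniz, MvPolynomial.pderiv_X] <;> ring

theorem isRelPrime_map_equiv {R R' : Type*} [CommRing R] [CommRing R'] (φ : R ≃+* R') {p g : R}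
    (h : IsRelPrime p g) : IsRelPrime (φ p) (φ g) := by
  intro d hp hg
  have h1 := h (d := φ.symm d) (by simpa using map_dvd φ.symm hp)
    (by simpa using map_dvd φ.symm hg)
  simpa using h1.map φ

open Polynomial in
theorem bivariate_aeval_X_one (a : ℂ[X]) :
    bivariate (aeval (MvPolynomial.X 1 : Poly) a) = C a := by
  have h := aeval_algHom_apply (CAlgHom (R := ℂ) (A := ℂ[X])) X a
  rw [← Polynomial.aeval_algHom_apply, bivariate_X_one]
  simpa using h

open Polynomial in
theorem exists_aeval_X_one_mem {p g : Poly} (h : IsRelPrime p g) :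
    ∃ a : ℂ[X], a ≠ 0 ∧ aeval (MvPolynomial.X 1 : Poly) a ∈ Ideal.span {p, g} := by
  classical
  let : NormalizedGCDMonoid ℂ[X] := Nonempty.some inferInstance
  obtain ⟨a, a0, ha⟩ := exists_ne_zero_C_mem_span_pair
    (isRelPrime_map_equiv bivariate.toRingEquiv h)
  refine ⟨a, a0, ?_⟩
  rw [Ideal.mem_span_pair] at ha ⊢
  obtain ⟨u, v, huv⟩ := ha
  refine ⟨bivariate.symm u, bivariate.symm v, bivariate.injective ?_⟩
  rw [bivariate_aeval_X_one, ← huv]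
  simp

open Polynomial in
theorem exists_aeval_X_zero_mem {p g : Poly} (h : IsRelPrime p g) :
    ∃ a : ℂ[X], a ≠ 0 ∧ aeval (MvPolynomial.X 0 : Poly) a ∈ Ideal.span {p, g} := by
  let σ := MvPolynomial.renameEquiv ℂ (Equiv.swap (0 : Fin 2) 1)
  obtain ⟨a, a0, ha⟩ := exists_aeval_X_one_mem (isRelPrime_map_equiv σ.toRingEquiv h)
  refine ⟨a, a0, ?_⟩
  rw [Ideal.mem_span_pair] at ha ⊢
  obtain ⟨u, v, huv⟩ := ha
  refine ⟨σ.symm u, σ.symm v, σ.injective ?_⟩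
  have hX : σ (MvPolynomial.X 0) = MvPolynomial.X 1 := by simp [σ]
  rw [← Polynomial.aeval_algHom_apply, hX, ← huv]
  simp

/-- Two curves without common component meet in a finite scheme. -/
theorem finiteDimensional_quotient_span_pair {p g : Poly} (h : IsRelPrime p g) :
    FiniteDimensional ℂ (Poly ⧸ Ideal.span {p, g}) := by
  set I := Ideal.span {p, g}
  -- Eliminating either variable leaves a nonzero one-variable polynomial in the ideal, so both
  -- coordinate classes are algebraic; an integral algebra of finite type is finite.
  have hint : ∀ i : Fin 2, IsIntegral ℂ (Ideal.Quotient.mkₐ ℂ I (MvPolynomial.X i)) := by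
    intro i
    have : ∃ a : Polynomial ℂ, a ≠ 0 ∧ Polynomial.aeval (MvPolynomial.X i : Poly) a ∈ I := by
      fin_cases i
      · exact exists_aeval_X_zero_mem h
      · exact exists_aeval_X_one_mem h
    obtain ⟨a, a0, ha⟩ := this
    refine IsAlgebraic.isIntegral ⟨a, a0, ?_⟩
    rw [Polynomial.aeval_algHom_apply]
    exact Ideal.Quotient.eq_zero_iff_mem.2 ha
  have : Algebra.IsIntegral ℂ (Poly ⧸ I) := by
    constructor
    intro x
    obtain ⟨q, rfl⟩ := Ideal.Quotient.mkₐ_surjective ℂ I x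
    induction q using MvPolynomial.induction_on with
    | C c => exact isIntegral_algebraMap (R := ℂ) (A := Poly ⧸ I) (x := c)
    | add p q hp hq => rw [map_add]; exact hp.add hq
    | mul_X p i hp => rw [map_mul]; exact hp.mul (hint i)
  exact Algebra.IsIntegral.finite

end

end Isopair

/-! ### Modules over `D[X]` annihilated by a prime polynomial. -/

namespace Isopair

open ContinuousLinearMap Cardinal

noncomputable section

-- With a common denominator for all generators, multiplication by `X` preserves the `D`-span of
-- `e`, so the `D[X]`-span exceeds the `D`-span only by torsion.
open Polynomial Submodule in
theorem exists_smul_mem_span_of_mem_span {D H : Type*} [CommRing D] [IsDomain D] [AddCommGroup H]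
    [Module D H] [Module D[X] H] [IsScalarTower D D[X] H] {M : ℕ} (e : Fin M → H)
    (he : ∀ i, ∃ d : D, d ≠ 0 ∧ d • (X : D[X]) • e i ∈ span D (Set.range e))
    {v : H} (hv : v ∈ span D[X] (Set.range e)) :
    ∃ d : D, d ≠ 0 ∧ d • v ∈ span D (Set.range e) := by
  have hcomm : ∀ (d : D) (q : D[X]) (x : H), d • q • x = q • d • x := by
    intro d q x
    rw [← algebraMap_smul D[X] d x, smul_smul, ← algebraMap_smul D[X] d (q • x), smul_smul,
      mul_comm]
  choose d d0 hd using he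
  have hX : ∀ x ∈ span D (Set.range e), (∏ i, d i) • (X : D[X]) • x ∈ span D (Set.range e) := by
    intro x hx
    induction hx using span_induction with
    | mem x hx =>
      obtain ⟨i, rfl⟩ := hx
      rw [← Finset.prod_erase_mul _ _ (Finset.mem_univ i), mul_smul]
      exact smul_mem _ _ (hd i)
    | zero => simp
    | add x y _ _ hx hy => rw [smul_add, smul_add]; exact add_mem hx hy
    | smul a x _ hx =>
      rw [← hcomm, smul_comm]
      exact smul_mem _ _ hx
  have hdd : ∏ i, d i ≠ 0 := Finset.prod_ne_zero_iff.2 fun i _ => d0 i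
  have hXn : ∀ (n : ℕ), ∀ x ∈ span D (Set.range e),
      (∏ i, d i) ^ n • (X : D[X]) ^ n • x ∈ span D (Set.range e) := by
    intro n
    induction n with
    | zero => intro x hx; simpa using hx
    | succ n ih =>
      intro x hx
      have := ih _ (hX x hx)
      rwa [← hcomm, smul_smul, smul_smul, ← pow_succ, ← pow_succ] at this
  have hq : ∀ (q : D[X]), ∀ x ∈ span D (Set.range e),
      ∃ c : D, c ≠ 0 ∧ c • q • x ∈ span D (Set.range e) := by
    intro q
    induction q using Polynomial.induction_on' with
    | add q r hq hr =>
      intro x hx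
      obtain ⟨c, c0, hc⟩ := hq x hx
      obtain ⟨c', c0', hc'⟩ := hr x hx
      refine ⟨c' * c, mul_ne_zero c0' c0, ?_⟩
      rw [add_smul, smul_add]
      refine add_mem ?_ ?_
      · rw [mul_smul]; exact smul_mem _ _ hc
      · rw [mul_comm, mul_smul]; exact smul_mem _ _ hc'
    | monomial n a =>
      intro x hx
      refine ⟨_, pow_ne_zero n hdd, ?_⟩
      rw [← C_mul_X_pow_eq_monomial, ← smul_eq_C_mul, smul_assoc, smul_comm]
      exact smul_mem _ _ (hXn n x hx)
  induction hv using span_induction with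
  | mem x hx => exact ⟨1, one_ne_zero, by rw [one_smul]; exact subset_span hx⟩
  | zero => exact ⟨1, one_ne_zero, by simp⟩
  | add x y _ _ hx hy =>
    obtain ⟨c, c0, hc⟩ := hx
    obtain ⟨c', c0', hc'⟩ := hy
    refine ⟨c' * c, mul_ne_zero c0' c0, ?_⟩
    rw [smul_add]
    refine add_mem ?_ ?_
    · rw [mul_smul]; exact smul_mem _ _ hc
    · rw [mul_comm, mul_smul]; exact smul_mem _ _ hc'
  | smul q x _ hx =>
    obtain ⟨c, c0, hc⟩ := hx
    obtain ⟨c', c0', hc'⟩ := hq q _ hc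
    refine ⟨c' * c, mul_ne_zero c0' c0, ?_⟩
    rwa [← hcomm, smul_smul] at hc'

open Polynomial Submodule in
/-- A generating family of a `D[X]`-module killed by a prime polynomial `p`, whose `D`-span is up
to torsion stable under `X`, generates up to torsion the same module as a subfamily smaller by the
factor `deg p`. -/
theorem exists_subset_generators {D H : Type*} [CommRing D] [IsDomain D] [AddCommGroup H]
    [Module D H] [Module D[X] H] [IsScalarTower D D[X] H] {p : D[X]} (hp : Prime p)
    (hpH : ∀ h : H, p • h = 0) {M : ℕ} (e : Fin M → H)
    (he : ∀ i, ∃ d : D, d ≠ 0 ∧ d • (X : D[X]) • e i ∈ span D (Set.range e)) :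
    ∃ J : Finset (Fin M), J.card * p.natDegree ≤ M ∧
      ∃ g : D[X], ¬ p ∣ g ∧ ∀ i, g • e i ∈ span D[X] (e '' J) := by
  classical
  -- Linear independence over the domain `D[X]/(p)`, phrased without passing to the quotient.
  let Indep : Finset (Fin M) → Prop := fun J =>
    ∀ q : Fin M → D[X], ∑ i ∈ J, q i • e i = 0 → ∀ i ∈ J, p ∣ q i
  obtain ⟨J, hJ, hmax⟩ := Finset.exists_max_image (Finset.univ.filter Indep) Finset.card
    ⟨∅, by simp [Indep]⟩
  replace hJ : Indep J := by simpa using hJ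
  refine ⟨J, ?_, ?_⟩
  -- The vectors `X^j • e i` with `i ∈ J`, `j < deg p` are independent over `D`: a relation has
  -- polynomial coefficients divisible by `p` but of smaller degree. Scaled by `c`, they lie in the
  -- `D`-span of `M` vectors, which bounds their number.
  · have hv : ∀ k : J × Fin p.natDegree, ∃ c : D, c ≠ 0 ∧
        c • (X : D[X]) ^ (k.2 : ℕ) • e k.1 ∈ span D (Set.range e) := fun k =>
      exists_smul_mem_span_of_mem_span e he (smul_mem _ _ (subset_span ⟨_, rfl⟩))
    choose c c0 hc using hv
    have hli : LinearIndependent D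
        (fun k : J × Fin p.natDegree => c k • (X : D[X]) ^ (k.2 : ℕ) • e k.1) := by
      rw [Fintype.linearIndependent_iff]
      intro a ha k
      let q : Fin M → D[X] := fun i => if hi : i ∈ J then
        ∑ j : Fin p.natDegree, C (a (⟨i, hi⟩, j) * c (⟨i, hi⟩, j)) * X ^ (j : ℕ) else 0
      have hq0 : ∑ i ∈ J, q i • e i = 0 := by
        rw [← Finset.sum_coe_sort J, ← ha, Fintype.sum_prod_type]
        refine Finset.sum_congr rfl fun i _ => ?_
        simp only [q, i.2, dite_true, Finset.sum_smul]
        refine Finset.sum_congr rfl fun j _ => ?_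
        rw [← smul_eq_C_mul, smul_assoc, mul_smul]
      have hdvd := hJ q hq0 k.1 k.1.2
      have hqk : q k.1 = ∑ j : Fin p.natDegree, C (a (k.1, j) * c (k.1, j)) * X ^ (j : ℕ) := by
        simp [q]
      have hz : q k.1 = 0 := by
        refine eq_zero_of_dvd_of_degree_lt hdvd ?_
        rw [hqk, degree_eq_natDegree hp.ne_zero]
        exact (degree_sum_fin_lt (n := p.natDegree) fun j => a (k.1, j) * c (k.1, j))
      have hco := congrArg (fun r => coeff r (k.2 : ℕ)) hz
      simp only [hqk, finsetSum_coeff, coeff_C_mul, coeff_X_pow, coeff_zero, mul_ite, mul_one,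
        mul_zero, Fin.val_inj] at hco
      rw [Finset.sum_ite_eq] at hco
      simpa [c0] using hco
    have hle := linearIndependent_le_span_aux' (R := D)
      (fun k : J × Fin p.natDegree => c k • (X : D[X]) ^ (k.2 : ℕ) • e k.1) hli (Set.range e)
      (by rintro _ ⟨k, rfl⟩; exact hc k)
    have h2 := hle.trans (Fintype.card_range_le e)
    simpa using h2
  · have hg : ∀ i, ∃ g : D[X], ¬ p ∣ g ∧ g • e i ∈ span D[X] (e '' J) := by
      intro i
      by_cases hi : i ∈ J
      · exact ⟨1, fun h => hp.not_isUnit (isUnit_of_dvd_one h),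
          smul_mem _ _ (subset_span ⟨i, hi, rfl⟩)⟩
      -- By maximality a new index brings a relation. Its coefficient at `i` is not divisible by
      -- `p`: otherwise that term would vanish and the rest would contradict the independence of
      -- `J`.
      · have hnot : ¬ Indep (insert i J) := by
          intro h
          have := hmax (insert i J) (by simpa using h)
          rw [Finset.card_insert_of_notMem hi] at this
          omega
        simp only [Indep, not_forall] at hnot
        obtain ⟨q, hq, j, hj, hqj⟩ := hnot
        rw [Finset.sum_insert hi] at hq
        refine ⟨q i, fun hdvd => ?_, ?_⟩
        · obtain ⟨r, hr⟩ := hdvd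
          rw [hr, mul_comm, mul_smul, hpH, smul_zero, zero_add] at hq
          rcases Finset.mem_insert.1 hj with rfl | hj
          · exact hqj ⟨r, hr⟩
          · exact hqj (hJ q hq j hj)
        · rw [eq_neg_of_add_eq_zero_left hq]
          exact neg_mem (sum_mem fun j hj => smul_mem _ _ (subset_span ⟨j, hj, rfl⟩))
    choose g hg hge using hg
    refine ⟨∏ i, g i, fun h => ?_, fun i => ?_⟩
    · obtain ⟨i, -, hi⟩ := (hp.dvd_finsetProd_iff _).1 h
      exact hg i hi
    · rw [← Finset.prod_erase_mul _ _ (Finset.mem_univ i), mul_smul]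
      exact smul_mem _ _ (hge i)

end

end Isopair

/-! ### The polynomial calculus, near cyclicity and direct sums. -/

namespace Isopair

open ContinuousLinearMap Cardinal

noncomputable section

section Operators

variable {H : Type*} [NormedAddCommGroup H] [InnerProductSpace ℂ H]

theorem polyEval_monomial (S T : H →L[ℂ] H) (m : Fin 2 →₀ ℕ) (c : ℂ) :
    polyEval S T (MvPolynomial.monomial m c) = c • (S ^ m 0 * T ^ m 1) := by
  have h : MvPolynomial.monomial m c = c • (MvPolynomial.basisMonomials (Fin 2) ℂ) m := by
    simp [MvPolynomial.coe_basisMonomials, MvPolynomial.smul_monomial]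
  rw [h, map_smul, polyEval, Module.Basis.constr_basis]

theorem polyEval_mul {S T : H →L[ℂ] H} (hST : Commute S T) (p q : Poly) :
    polyEval S T (p * q) = polyEval S T p * polyEval S T q := by
  induction p using MvPolynomial.induction_on' with
  | add p p' hp hp' => rw [add_mul, map_add, map_add, hp, hp', add_mul]
  | monomial m c =>
    induction q using MvPolynomial.induction_on' with
    | add q q' hq hq' => rw [mul_add, map_add, map_add, hq, hq', mul_add]
    | monomial n d =>
      have h : T ^ m 1 * S ^ n 0 = S ^ n 0 * T ^ m 1 := (hST.symm.pow_pow _ _).eq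
      rw [MvPolynomial.monomial_mul, polyEval_monomial, polyEval_monomial, polyEval_monomial,
        smul_mul_smul_comm, Finsupp.add_apply, Finsupp.add_apply, pow_add, pow_add]
      congr 1
      rw [mul_assoc, ← mul_assoc (S ^ n 0), ← h]
      simp only [mul_assoc]

theorem polyEval_C (S T : H →L[ℂ] H) (c : ℂ) : polyEval S T (MvPolynomial.C c) = c • 1 := by
  rw [MvPolynomial.C_apply, polyEval_monomial]
  simp

theorem polyEval_one (S T : H →L[ℂ] H) : polyEval S T 1 = 1 := by
  rw [← MvPolynomial.C_1, polyEval_C, one_smul]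

theorem polyEval_X_zero (S T : H →L[ℂ] H) : polyEval S T (MvPolynomial.X 0) = S := by
  rw [MvPolynomial.X, polyEval_monomial]
  simp

theorem polyEval_X_one (S T : H →L[ℂ] H) : polyEval S T (MvPolynomial.X 1) = T := by
  rw [MvPolynomial.X, polyEval_monomial]
  simp

/-- The functional calculus of a commuting pair as an algebra homomorphism. -/
def polyEvalHom {S T : H →L[ℂ] H} (hST : Commute S T) : Poly →ₐ[ℂ] (H →L[ℂ] H) :=
  AlgHom.ofLinearMap (polyEval S T) (polyEval_one S T) (polyEval_mul hST)

theorem polyEvalHom_apply {S T : H →L[ℂ] H} (hST : Commute S T) (q : Poly) :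
    polyEvalHom hST q = polyEval S T q := rfl

theorem polyEval_mem_polySpan (S T : H →L[ℂ] H) {k : ℕ} (f : Fin k → H) (q : Poly) (j : Fin k) :
    polyEval S T q (f j) ∈ polySpan S T f := by
  classical
  refine ⟨Pi.single j q, ?_⟩
  rw [Finset.sum_eq_single j]
  · simp
  · intro i _ hi; simp [hi]
  · simp

theorem polySpan_le {S T : H →L[ℂ] H} {k : ℕ} {f : Fin k → H} {W : Submodule ℂ H} :
    polySpan S T f ≤ W ↔ ∀ q j, polyEval S T q (f j) ∈ W := by
  refine ⟨fun h q j => h (polyEval_mem_polySpan S T f q j), ?_⟩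
  rintro h _ ⟨q, rfl⟩
  exact sum_mem fun j _ => h _ _

theorem self_mem_polySpan (S T : H →L[ℂ] H) {k : ℕ} (f : Fin k → H) (j : Fin k) :
    f j ∈ polySpan S T f := by
  simpa [polyEval_one] using polyEval_mem_polySpan S T f 1 j

theorem finiteDimensional_quotient_of_le {V : Type*} [AddCommGroup V] [Module ℂ V]
    {A B : Submodule ℂ V} (h : A ≤ B) [FiniteDimensional ℂ (V ⧸ A)] :
    FiniteDimensional ℂ (V ⧸ B) :=
  Module.Finite.of_surjective (Submodule.factor h) (Submodule.factor_surjective h)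

theorem HasNearlyCyclicVectors.mono {S T : H →L[ℂ] H} {k l : ℕ}
    (h : HasNearlyCyclicVectors S T k) (hkl : k ≤ l) : HasNearlyCyclicVectors S T l := by
  obtain ⟨f, hf⟩ := h
  refine ⟨fun i => if hi : i < k then f ⟨i, hi⟩ else 0, ?_⟩
  refine finiteDimensional_quotient_of_le (A := (polySpan S T f).topologicalClosure)
    (Submodule.topologicalClosure_mono ?_)
  rw [polySpan_le]
  intro q j
  have := polyEval_mem_polySpan S T
    (fun i : Fin l => if hi : (i : ℕ) < k then f ⟨i, hi⟩ else 0) q (Fin.castLE hkl j)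
  simpa using this

theorem HasCyclicVectors.hasNearlyCyclicVectors {S T : H →L[ℂ] H} {k : ℕ}
    (h : HasCyclicVectors S T k) : HasNearlyCyclicVectors S T k := by
  obtain ⟨f, hf⟩ := h
  refine ⟨f, ?_⟩
  rw [hf]
  infer_instance

theorem HasNearlyCyclicVectors.isAtMostNearlyCyclic {S T : H →L[ℂ] H} {k : ℕ}
    (h : HasNearlyCyclicVectors S T k) : IsAtMostNearlyCyclic S T k := by
  classical
  exact ⟨Nat.find ⟨k, h⟩, Nat.find_min' _ h, Nat.find_spec ⟨k, h⟩, fun l hl => Nat.find_min _ hl⟩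

/-- If `p(S,T) = 0` and `g` is relatively prime to `p`, then applying multiples of `g` to vectors
that generate a subspace of finite codimension generates a subspace of finite codimension. -/
theorem finiteDimensional_quotient_of_mul_mem {S T : H →L[ℂ] H} (hST : Commute S T) {p g : Poly}
    (hpg : IsRelPrime p g) (hp : polyEval S T p = 0) {k : ℕ} (e : Fin k → H)
    [he : FiniteDimensional ℂ (H ⧸ (polySpan S T e).topologicalClosure)] (W : Submodule ℂ H)
    (hW : IsClosed (W : Set H)) (hg : ∀ q i, polyEval S T (g * q) (e i) ∈ W) :
    FiniteDimensional ℂ (H ⧸ W) := by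
  -- Modulo `W`, the orbit map of each generator kills both `p` and `g`, so it factors through the
  -- finite dimensional `ℂ[z,w]/(p,g)`.
  let L : Fin k → Poly →ₗ[ℂ] (H ⧸ W) := fun i =>
    W.mkQ ∘ₗ (ContinuousLinearMap.apply ℂ H (e i)).toLinearMap ∘ₗ polyEval S T
  have hLapp : ∀ i q, L i q = W.mkQ (polyEval S T q (e i)) := fun i q => rfl
  set I := Ideal.span {p, g} with hI
  have hker : ∀ i, I.restrictScalars ℂ ≤ LinearMap.ker (L i) := by
    intro i x hx
    obtain ⟨u, v, rfl⟩ := Ideal.mem_span_pair.1 (show x ∈ Ideal.span {p, g} from hx)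
    rw [LinearMap.mem_ker, hLapp, map_add, polyEval_mul hST, hp, mul_zero, zero_add, mul_comm]
    exact (Submodule.Quotient.mk_eq_zero W).2 (hg v i)
  have hfin : FiniteDimensional ℂ (Poly ⧸ I.restrictScalars ℂ) :=
    have := finiteDimensional_quotient_span_pair hpg
    Module.Finite.equiv (Submodule.Quotient.restrictScalarsEquiv ℂ I).symm
  have hrange : ∀ i, FiniteDimensional ℂ (LinearMap.range (L i)) := by
    intro i
    rw [← Submodule.range_liftQ (I.restrictScalars ℂ) (L i) (hker i)]
    infer_instance
  let F : Submodule ℂ (H ⧸ W) := ⨆ i, LinearMap.range (L i)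
  have hF : FiniteDimensional ℂ F := Submodule.finiteDimensional_iSup _
  have : IsClosed (W : Set H) := hW
  have hFc : IsClosed (F : Set (H ⧸ W)) := F.closed_of_finiteDimensional
  -- The finite dimensional `F` is closed in the normed quotient, so its preimage contains the
  -- closure of the span and not only the span.
  have hle : (polySpan S T e).topologicalClosure ≤ F.comap W.mkQ := by
    refine Submodule.topologicalClosure_minimal _ ?_ (hFc.preimage continuous_quot_mk)
    rw [polySpan_le]
    intro q j
    exact Submodule.mem_iSup_of_mem j ⟨q, rfl⟩
  have hquot : FiniteDimensional ℂ ((H ⧸ W) ⧸ F) := by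
    refine Module.Finite.of_surjective
      ((polySpan S T e).topologicalClosure.liftQ (F.mkQ ∘ₗ W.mkQ) ?_) ?_
    · intro x hx
      have := hle hx
      simpa using this
    · rw [← LinearMap.range_eq_top, Submodule.range_liftQ, LinearMap.range_eq_top]
      exact (Submodule.mkQ_surjective F).comp (Submodule.mkQ_surjective W)
  exact Module.Finite.of_submodule_quotient F

end Operators

section DirectSum

/-- The inclusion of a summand into a Hilbert space direct sum. -/
def inclusion {ι : Type*} [Fintype ι] [DecidableEq ι] (K : ι → Type*) [∀ j, NormedAddCommGroup (K j)]
    [∀ j, InnerProductSpace ℂ (K j)] (j : ι) : K j →L[ℂ] PiLp 2 K :=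
  ((PiLp.continuousLinearEquiv 2 ℂ K).symm : (∀ j, K j) →L[ℂ] PiLp 2 K) ∘L
    ContinuousLinearMap.single ℂ K j

theorem inclusion_apply {ι : Type*} [Fintype ι] [DecidableEq ι] {K : ι → Type*}
    [∀ j, NormedAddCommGroup (K j)] [∀ j, InnerProductSpace ℂ (K j)] (j : ι) (v : K j) (i : ι) :
    inclusion K j v i = (Pi.single j v : ∀ j, K j) i := rfl

variable {ι : Type*} [Fintype ι] {K : ι → Type*} [∀ j, NormedAddCommGroup (K j)]
    [∀ j, InnerProductSpace ℂ (K j)]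

theorem directSum_pow_apply (A : ∀ j, K j →L[ℂ] K j) (n : ℕ) (x : PiLp 2 K) (j : ι) :
    (directSum A ^ n) x j = (A j ^ n) (x j) := by
  induction n generalizing x with
  | zero => rfl
  | succ n ih =>
    rw [pow_succ, pow_succ]
    exact ih (directSum A x)

theorem polyEval_directSum_apply (S T : ∀ j, K j →L[ℂ] K j) (q : Poly) (x : PiLp 2 K) (j : ι) :
    polyEval (directSum S) (directSum T) q x j = polyEval (S j) (T j) q (x j) := by
  induction q using MvPolynomial.induction_on' with
  | add p q hp hq => simp [hp, hq]
  | monomial m c =>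
    rw [polyEval_monomial, polyEval_monomial]
    change c • ((directSum S ^ m 0) ((directSum T ^ m 1) x) j)
      = c • (S j ^ m 0) ((T j ^ m 1) (x j))
    rw [directSum_pow_apply, directSum_pow_apply]

theorem sum_inclusion [DecidableEq ι] (x : PiLp 2 K) : ∑ j, inclusion K j (x j) = x := by
  ext i
  simp [inclusion_apply]

theorem hasNearlyCyclicVectors_directSum {p : ι → Poly}
    (hrel : ∀ i j, i ≠ j → IsRelPrime (p i) (p j)) {S T : ∀ j, K j →L[ℂ] K j}
    (hcomm : ∀ j, Commute (S j) (T j)) (hann : ∀ j, polyEval (S j) (T j) (p j) = 0) {k : ℕ}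
    (h : ∀ j, HasNearlyCyclicVectors (S j) (T j) k) :
    HasNearlyCyclicVectors (directSum S) (directSum T) k := by
  classical
  choose f hf using h
  let F : Fin k → PiLp 2 K := fun i => WithLp.toLp 2 fun j => f j i
  refine ⟨F, ?_⟩
  set W := (polySpan (directSum S) (directSum T) F).topologicalClosure with hW
  have hWc : IsClosed (W : Set (PiLp 2 K)) := Submodule.isClosed_topologicalClosure _
  have hfin : ∀ j, FiniteDimensional ℂ (K j ⧸ W.comap (inclusion K j).toLinearMap) := by
    intro j
    have := hf j
    -- The multiplier is the product of the `p i` with `i ≠ j`: it annihilates every other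
    -- coordinate of `F i` and is relatively prime to `p j`.
    refine finiteDimensional_quotient_of_mul_mem (hcomm j)
      (IsRelPrime.prod_right (t := Finset.univ.erase j) (s := p) fun i hi =>
        hrel j i (Finset.ne_of_mem_erase hi).symm) (hann j) (f j) _
      (hWc.preimage (inclusion K j).continuous) ?_
    intro q i
    have hmem := Submodule.le_topologicalClosure _ (polyEval_mem_polySpan (directSum S)
      (directSum T) F ((∏ i ∈ Finset.univ.erase j, p i) * q) i)
    have heq : polyEval (directSum S) (directSum T) ((∏ i ∈ Finset.univ.erase j, p i) * q) (F i)
        = inclusion K j (polyEval (S j) (T j) ((∏ i ∈ Finset.univ.erase j, p i) * q) (f j i)) := by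
      ext j'
      rw [polyEval_directSum_apply, inclusion_apply]
      by_cases hj : j' = j
      · subst hj; simp [F]
      · rw [Pi.single_eq_of_ne hj, ← Finset.mul_prod_erase _ _
          (Finset.mem_erase.2 ⟨hj, Finset.mem_univ _⟩), mul_assoc, polyEval_mul (hcomm j'), hann]
        simp
    rw [heq] at hmem
    exact hmem
  have hrange : ∀ j, FiniteDimensional ℂ
      (LinearMap.range (W.mkQ ∘ₗ (inclusion K j).toLinearMap)) := by
    intro j
    have hk : LinearMap.ker (W.mkQ ∘ₗ (inclusion K j).toLinearMap)
        = W.comap (inclusion K j).toLinearMap := by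
      rw [LinearMap.ker_comp, Submodule.ker_mkQ]
    have := hfin j
    rw [← hk] at this
    exact Module.Finite.equiv (LinearMap.quotKerEquivRange _)
  have htop : (⨆ j, LinearMap.range (W.mkQ ∘ₗ (inclusion K j).toLinearMap)) = ⊤ := by
    rw [eq_top_iff]
    intro x _
    obtain ⟨x, rfl⟩ := Submodule.mkQ_surjective W x
    rw [← sum_inclusion x, map_sum]
    exact sum_mem fun j _ => Submodule.mem_iSup_of_mem j ⟨x j, rfl⟩
  have := Submodule.finiteDimensional_iSup fun j =>
    LinearMap.range (W.mkQ ∘ₗ (inclusion K j).toLinearMap)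
  rw [htop] at this
  exact Module.Finite.equiv (Submodule.topEquiv (R := ℂ) (M := PiLp 2 K ⧸ W))

end DirectSum

end

end Isopair

/-! ### Slices of inner toral curves. -/

namespace Isopair

open ContinuousLinearMap Cardinal

noncomputable section

open Polynomial

/-- The restriction `p(·, b)` of `p` to a horizontal line. -/
def slice (p : Poly) (b : ℂ) : ℂ[X] := (bivariate p).map (evalRingHom b)

theorem eval_slice (p : Poly) (a b : ℂ) :
    (slice p b).eval a = MvPolynomial.eval ![a, b] p := (eval_eq_eval_map_bivariate a b p).symm

theorem IsInnerToral.of_dvd {p P : Poly} (hP : IsInnerToral P) (h : p ∣ P) : IsInnerToral p := by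
  obtain ⟨q, rfl⟩ := h
  intro x hx
  refine hP x ?_
  simp only [zeroSet, Set.mem_ofPred_eq, map_mul] at hx ⊢
  rw [hx, zero_mul]

/-- Otherwise the zero set contains a whole line `w = b`; its points over `z = 0` and `z = 2` would
force both `‖b‖ < 1` and `1 < ‖b‖`. -/
theorem IsInnerToral.natDegree_bivariate_pos {p : Poly} (hp : IsInnerToral p)
    (hirr : Irreducible p) : 0 < (bivariate p).natDegree := by
  by_contra h
  obtain ⟨a, ha⟩ := natDegree_eq_zero.1 (Nat.eq_zero_of_not_pos h)
  have hdeg : a.degree ≠ 0 := by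
    intro h0
    refine hirr.not_isUnit ?_
    rw [← MulEquiv.isUnit_map bivariate, ← ha]
    exact isUnit_C.2 (isUnit_iff_degree_eq_zero.2 h0)
  obtain ⟨b, hb⟩ := IsAlgClosed.exists_root a hdeg
  have hz : ∀ c : ℂ, (c, b) ∈ zeroSet p := by
    intro c
    simp only [zeroSet, Set.mem_ofPred_eq]
    rw [← eval_slice, slice, ← ha]
    simpa using hb
  have h0 := hp _ (hz 0)
  have h2 := hp _ (hz 2)
  simp only [norm_zero, Complex.norm_ofNat] at h0 h2
  norm_num at h0 h2
  linarith

/-- For all but finitely many `b`, the slice `p(·, b)` has full degree and no singular zeros. -/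
theorem exists_generic_slice {p : Poly} (hirr : Irreducible p)
    (hdeg : 0 < (bivariate p).natDegree) :
    ∃ a : ℂ[X], a ≠ 0 ∧ ∀ b, a.eval b ≠ 0 →
      (slice p b).natDegree = (bivariate p).natDegree ∧
      ∀ c, (slice p b).eval c = 0 → MvPolynomial.eval ![c, b] (MvPolynomial.pderiv 0 p) ≠ 0 := by
  classical
  let : NormalizedGCDMonoid ℂ[X] := Nonempty.some inferInstance
  have hirr' : Irreducible (bivariate p) := (MulEquiv.irreducible_iff bivariate).2 hirr
  have hrel : IsRelPrime (bivariate p) (derivative (bivariate p)) := by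
    rw [hirr'.isRelPrime_iff_not_dvd]
    intro hd
    have h0 := eq_zero_of_dvd_of_natDegree_lt hd (natDegree_derivative_lt hdeg.ne')
    exact hdeg.ne' (derivative_eq_zero.1 h0)
  obtain ⟨a, a0, ha⟩ := exists_ne_zero_C_mem_span_pair hrel
  obtain ⟨u, v, huv⟩ := Ideal.mem_span_pair.1 ha
  -- The leading coefficient keeps the degree of the slice from dropping; the factor `a`, in the
  -- ideal of `p` and `∂p/∂z`, rules out their common zeros.
  refine ⟨a * (bivariate p).leadingCoeff, mul_ne_zero a0 (leadingCoeff_ne_zero.2 hirr'.ne_zero), ?_⟩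
  intro b hb
  rw [eval_mul] at hb
  refine ⟨natDegree_map_of_leadingCoeff_ne_zero _ (right_ne_zero_of_mul hb), ?_⟩
  intro c hc hd
  rw [eval_eq_eval_map_bivariate, bivariate_pderiv_zero] at hd
  have h := congrArg (fun q : ℂ[X][X] => (q.map (evalRingHom b)).eval c) huv
  simp only [Polynomial.map_add, Polynomial.map_mul, eval_add, eval_mul, hd, map_C, eval_C] at h
  rw [show eval c (map (evalRingHom b) (bivariate p)) = 0 from hc] at h
  simp only [mul_zero, add_zero, coe_evalRingHom] at h
  exact left_ne_zero_of_mul hb h.symm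

theorem IsInnerToral.mem_diskVariety_of_eval_slice {p : Poly} (hp : IsInnerToral p) {b c : ℂ}
    (hb : ‖b‖ < 1) (hc : (slice p b).eval c = 0) : (c, b) ∈ diskVariety p := by
  have hz : (c, b) ∈ zeroSet p := by
    rw [eval_slice] at hc
    exact hc
  have h := hp _ hz
  refine ⟨hz, ?_, hb⟩
  simp only at h
  rcases h with h | h | h
  · exact h.1
  · linarith [h.2]
  · linarith [h.2]

theorem infinite_disk : {b : ℂ | ‖b‖ < 1}.Infinite := by
  have h : {b : ℂ | ‖b‖ < 1} = Metric.ball 0 1 := by ext; simp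
  rw [h]
  exact infinite_of_mem_nhds (0 : ℂ) (Metric.ball_mem_nhds 0 one_pos)

/-- The slice through a generic height in the disk, avoiding finitely many heights. -/
theorem IsInnerToral.exists_regular_slice {p : Poly} (hp : IsInnerToral p)
    (hirr : Irreducible p) {F : Set ℂ} (hF : F.Finite) :
    ∃ b, ‖b‖ < 1 ∧ b ∉ F ∧ (slice p b).natDegree = (bivariate p).natDegree ∧
      ∀ c, (slice p b).eval c = 0 → (c, b) ∈ diskVariety p ∧ IsRegularPoint p (c, b) := by
  obtain ⟨a, a0, ha⟩ := exists_generic_slice hirr (hp.natDegree_bivariate_pos hirr)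
  obtain ⟨b, hb1, hb2⟩ := (infinite_disk.sdiff
    (hF.union (a.rootSet_finite ℂ))).nonempty
  rw [Set.mem_union, not_or] at hb2
  have hab : a.eval b ≠ 0 := fun h => hb2.2 (by
    rw [mem_rootSet]; exact ⟨a0, by simpa using h⟩)
  refine ⟨b, hb1, hb2.1, (ha b hab).1, fun c hc => ?_⟩
  have := hp.mem_diskVariety_of_eval_slice hb1 hc
  exact ⟨this, this.1, Or.inl ((ha b hab).2 c hc)⟩

end

end Isopair

/-! ### Isometries, defect spaces and eigenspaces of adjoints. -/

namespace Isopair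

open ContinuousLinearMap Cardinal

noncomputable section

variable {H : Type*} [NormedAddCommGroup H] [InnerProductSpace ℂ H]

theorem rank_ker_comp_inf_le {V : Type*} [AddCommGroup V] [Module ℂ V] (f g : V →ₗ[ℂ] V)
    (E : Submodule ℂ V) (hf : ∀ v ∈ E, f v ∈ E) :
    Module.rank ℂ ↥(LinearMap.ker (g ∘ₗ f) ⊓ E) ≤
      Module.rank ℂ ↥(LinearMap.ker f ⊓ E) + Module.rank ℂ ↥(LinearMap.ker g ⊓ E) := by
  let φ : ↥(LinearMap.ker (g ∘ₗ f) ⊓ E) →ₗ[ℂ] ↥(LinearMap.ker g ⊓ E) :=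
    f.restrict fun v hv => ⟨hv.1, hf v hv.2⟩
  rw [← LinearMap.rank_range_add_rank_ker φ, add_comm]
  refine add_le_add ?_ (Submodule.rank_le _)
  let ψ : LinearMap.ker φ →ₗ[ℂ] ↥(LinearMap.ker f ⊓ E) :=
    LinearMap.codRestrict _ ((Submodule.subtype _) ∘ₗ (Submodule.subtype _)) fun v =>
      ⟨congrArg Subtype.val v.2, v.1.2.2⟩
  refine LinearMap.rank_le_of_injective ψ fun v w h => ?_
  exact Subtype.ext (Subtype.ext (congrArg (fun z : ↥(LinearMap.ker f ⊓ E) => (z : V)) h))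

variable [CompleteSpace H]

theorem mem_ker_adjoint {A : H →L[ℂ] H} {v : H} :
    v ∈ LinearMap.ker (adjoint A : H →L[ℂ] H).toLinearMap ↔ ∀ x, inner ℂ v (A x) = 0 := by
  rw [LinearMap.mem_ker]
  constructor
  · intro h x
    rw [← adjoint_inner_left]
    rw [show adjoint A v = 0 from h, inner_zero_left]
  · intro h
    refine (inner_self_eq_zero (𝕜 := ℂ)).1 ?_
    change inner ℂ (adjoint A v) (adjoint A v) = 0
    rw [adjoint_inner_left, h]

theorem mem_ker_adjoint_sub {A : H →L[ℂ] H} {c : ℂ} {v : H} :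
    v ∈ LinearMap.ker (adjoint (A - c • (1 : H →L[ℂ] H)) : H →L[ℂ] H).toLinearMap ↔
      ∀ x, inner ℂ v (A x) = c * inner ℂ v x := by
  rw [mem_ker_adjoint]
  refine forall_congr' fun x => ?_
  change inner ℂ v (A x - c • x) = 0 ↔ _
  rw [inner_sub_right, inner_smul_right, sub_eq_zero]

theorem adjoint_apply_apply_of_isometry {V : H →L[ℂ] H} (hV : Isometry V) (x : H) :
    adjoint V (V x) = x := by
  have h := (isometry_iff_adjoint_comp_self V).1 hV
  exact congrArg (fun A : H →L[ℂ] H => A x) h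

theorem sub_mem_ker_adjoint {V : H →L[ℂ] H} (hV : Isometry V) (x : H) :
    x - V (adjoint V x) ∈ LinearMap.ker (adjoint V : H →L[ℂ] H).toLinearMap := by
  change adjoint V (x - V (adjoint V x)) = 0
  rw [map_sub, adjoint_apply_apply_of_isometry hV, sub_self]

theorem mem_range_of_orthogonal_ker_adjoint {V : H →L[ℂ] H} (hV : Isometry V) {u : H}
    (hu : ∀ v, adjoint V v = 0 → inner ℂ v u = 0) : ∃ x, V x = u := by
  refine ⟨adjoint V u, ?_⟩
  have hk : adjoint V (u - V (adjoint V u)) = 0 := sub_mem_ker_adjoint hV u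
  refine (sub_eq_zero.1 ((inner_self_eq_zero (𝕜 := ℂ)).1 ?_)).symm
  rw [inner_sub_right, hu _ hk, ← adjoint_inner_left, hk, inner_zero_left, sub_zero]

/-- The defect space of a pure isometry is wandering and generates the whole space. -/
theorem IsPureIsometry.eq_top_of_forall_pow_mem {V : H →L[ℂ] H} (hV : IsPureIsometry V)
    {W : Submodule ℂ H} (hW : IsClosed (W : Set H))
    (h : ∀ v, adjoint V v = 0 → ∀ n : ℕ, (V ^ n) v ∈ W) : W = ⊤ := by
  have : CompleteSpace W := hW.completeSpace_coe
  rw [← Submodule.orthogonal_eq_bot_iff, eq_bot_iff]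
  intro x hx
  have hiso : ∀ (n : ℕ) (u v : H), inner ℂ ((V ^ n) u) ((V ^ n) v) = inner ℂ u v := by
    intro n
    induction n with
    | zero => intro u v; rfl
    | succ n ih =>
      intro u v
      rw [pow_succ]
      change inner ℂ ((V ^ n) (V u)) ((V ^ n) (V v)) = _
      rw [ih, ← adjoint_inner_left, adjoint_apply_apply_of_isometry hV.1]
  -- If `x = V^n u` is orthogonal to `V^n ker V*`, then `u` is orthogonal to `ker V*` and hence lies
  -- in the range of `V`. Purity then forces `x = 0`.
  have hr : ∀ n : ℕ, ∃ u, (V ^ n) u = x := by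
    intro n
    induction n with
    | zero => exact ⟨x, rfl⟩
    | succ n ih =>
      obtain ⟨u, hu⟩ := ih
      obtain ⟨y, hy⟩ := mem_range_of_orthogonal_ker_adjoint (u := u) hV.1 fun v hv => by
        rw [← hiso n, hu]
        exact (Submodule.mem_orthogonal _ _).1 hx _ (h v hv n)
      refine ⟨y, ?_⟩
      rw [pow_succ]
      change (V ^ n) (V y) = x
      rw [hy, hu]
  have hx0 : x ∈ ⋂ n : ℕ, Set.range (V ^ n) := Set.mem_iInter.2 hr
  rw [hV.2] at hx0
  exact hx0

open Polynomial in
/-- A vector annihilated by a polynomial in `V*` is rational: a polynomial in `V` maps it to the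
`V`-invariant subspace generated by the defect space. -/
theorem exists_aeval_apply_mem {V : H →L[ℂ] H} (hV : Isometry V) {L : Submodule ℂ H}
    (hL : ∀ v, adjoint V v = 0 → v ∈ L) (hVL : ∀ v ∈ L, V v ∈ L) {q : ℂ[X]} (hq : q ≠ 0) {h : H}
    (hqh : aeval (adjoint V : H →L[ℂ] H) q h = 0) :
    ∃ d : ℂ[X], d ≠ 0 ∧ aeval V d h ∈ L := by
  have hpow : ∀ (n : ℕ), ∀ v ∈ L, (V ^ n) v ∈ L := by
    intro n
    induction n with
    | zero => exact fun v hv => hv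
    | succ n ih =>
      intro v hv
      rw [pow_succ]
      exact ih _ (hVL v hv)
  -- Telescoping: `1 - V V*` maps into the defect space.
  have hk : ∀ k : ℕ, (V ^ k) ((adjoint V ^ k : H →L[ℂ] H) h) - h ∈ L := by
    intro k
    induction k with
    | zero => simp
    | succ k ih =>
      have h1 := hpow k _ (hL _ (sub_mem_ker_adjoint hV ((adjoint V ^ k : H →L[ℂ] H) h)))
      have h2 := sub_mem ih h1
      rw [map_sub] at h2
      rw [pow_succ, pow_succ']
      convert h2 using 1
      change (V ^ k) (V (adjoint V ((adjoint V ^ k : H →L[ℂ] H) h))) - h = _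
      abel
  -- The reversed polynomial: modulo `L`, its value at `V` on `h` equals `V^N q(V*) h = 0` with `N =
  -- deg q`. Its constant term is the leading coefficient of `q`, so it is nonzero.
  refine ⟨∑ k ∈ q.support, monomial (q.natDegree - k) (q.coeff k), ?_, ?_⟩
  · intro h0
    have hc := congrArg (fun r => coeff r 0) h0
    simp only [finsetSum_coeff, coeff_monomial, coeff_zero] at hc
    rw [Finset.sum_eq_single q.natDegree] at hc
    · simp [hq] at hc
    · intro k hks hkn
      have := le_natDegree_of_mem_supp k hks
      rw [if_neg]
      omega
    · intro hn
      exact absurd (natDegree_mem_support_of_nonzero hq) hn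
  · have hsum : (V ^ q.natDegree) (aeval (adjoint V : H →L[ℂ] H) q h) =
        ∑ k ∈ q.support, q.coeff k • (V ^ q.natDegree) ((adjoint V ^ k : H →L[ℂ] H) h) := by
      rw [aeval_eq_sum_range, sum_apply, map_sum]
      symm
      refine Finset.sum_subset_zero_on_sdiff ?_ ?_ ?_
      · intro k hk
        exact Finset.mem_range.2 (Nat.lt_succ_of_le (le_natDegree_of_mem_supp k hk))
      · intro k hk
        have : q.coeff k = 0 := by simpa using (Finset.mem_sdiff.1 hk).2
        simp [this]
      · intro k _
        simp
    have hdapp : aeval V (∑ k ∈ q.support, monomial (q.natDegree - k) (q.coeff k)) h =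
        ∑ k ∈ q.support, q.coeff k • (V ^ (q.natDegree - k)) h := by
      rw [map_sum, sum_apply]
      refine Finset.sum_congr rfl fun k _ => ?_
      rw [aeval_monomial, ← Algebra.smul_def]
      rfl
    have hdiff : aeval V (∑ k ∈ q.support, monomial (q.natDegree - k) (q.coeff k)) h =
        -∑ k ∈ q.support, q.coeff k •
          (V ^ (q.natDegree - k)) ((V ^ k) ((adjoint V ^ k : H →L[ℂ] H) h) - h) := by
      have h0 : (V ^ q.natDegree) (aeval (adjoint V : H →L[ℂ] H) q h) = 0 := by
        rw [hqh, map_zero]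
      rw [hdapp, ← zero_sub, ← h0, hsum, eq_sub_iff_add_eq, ← Finset.sum_add_distrib]
      refine Finset.sum_congr rfl fun k hks => ?_
      rw [← smul_add, map_sub, add_sub_cancel]
      congr 1
      change (V ^ (q.natDegree - k) * V ^ k) _ = _
      rw [← pow_add, Nat.sub_add_cancel (le_natDegree_of_mem_supp k hks)]
    rw [hdiff]
    exact neg_mem (sum_mem fun k _ => Submodule.smul_mem _ _ (hpow _ _ (hk k)))

/-- The defect space of an isometry is at most as large as any eigenspace of its adjoint over the
open disk. -/
theorem mult_le_rank_ker_adjoint_sub {V : H →L[ℂ] H} (hV : Isometry V) {c : ℂ} (hc : ‖c‖ < 1) :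
    mult V ≤ Module.rank ℂ
      (LinearMap.ker (adjoint (V - c • (1 : H →L[ℂ] H)) : H →L[ℂ] H).toLinearMap) := by
  set A := V - c • (1 : H →L[ℂ] H) with hA
  set E := LinearMap.ker (adjoint A : H →L[ℂ] H).toLinearMap with hE
  have hEc : IsClosed (E : Set H) := ContinuousLinearMap.isClosed_ker (adjoint A : H →L[ℂ] H)
  have : CompleteSpace E := hEc.completeSpace_coe
  have hbound : ∀ x, (1 - ‖c‖) * ‖x‖ ≤ ‖A x‖ := by
    intro x
    have h1 : ‖V x‖ = ‖x‖ := (AddMonoidHomClass.isometry_iff_norm V).1 hV x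
    have h2 := norm_sub_norm_le (V x) (c • x)
    rw [h1, norm_smul] at h2
    change _ ≤ ‖V x - c • x‖
    linarith
  have hanti : AntilipschitzWith (Real.toNNReal (1 - ‖c‖)⁻¹) A := by
    refine AddMonoidHomClass.antilipschitz_of_bound A fun x => ?_
    have hpos : 0 < 1 - ‖c‖ := by linarith
    rw [Real.coe_toNNReal _ (inv_nonneg.2 hpos.le), inv_mul_eq_div, le_div_iff₀ hpos, mul_comm]
    exact hbound x
  have hrange : IsClosed (A.range : Set H) := by
    change IsClosed (Set.range A)
    exact hanti.isClosed_range A.uniformContinuous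
  have hEorth : ∀ v, v ∈ Eᗮ → ∃ x, A x = v := by
    intro v hv
    have : Eᗮ = A.range := by
      rw [hE, ← ContinuousLinearMap.orthogonal_range, Submodule.orthogonal_orthogonal_eq_closure]
      exact hrange.submodule_topologicalClosure_eq
    rw [this] at hv
    exact hv
  -- Orthogonal projection onto `E` is injective on `ker V*`. A vector in its kernel is `V u - c u`,
  -- since `V - c` is bounded below and so has closed range; applying `V*` gives `u = c V* u`, so `u
  -- = 0` because `‖c‖ < 1`.
  let φ : LinearMap.ker (adjoint V : H →L[ℂ] H).toLinearMap →ₗ[ℂ] E :=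
    E.orthogonalProjectionOnto.toLinearMap ∘ₗ Submodule.subtype _
  refine LinearMap.rank_le_of_injective φ ?_
  rw [← LinearMap.ker_eq_bot, LinearMap.ker_eq_bot']
  rintro ⟨v, hv⟩ hφ
  have hvE : v ∈ Eᗮ := by
    rw [← E.starProjection_apply_eq_zero_iff]
    exact congrArg Subtype.val hφ
  obtain ⟨u, rfl⟩ := hEorth v hvE
  have hu : u = c • adjoint V u := by
    have h1 : adjoint V (V u - c • u) = 0 := hv
    rwa [map_sub, adjoint_apply_apply_of_isometry hV, map_smul, sub_eq_zero] at h1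
  have hadj : ‖adjoint V u‖ ≤ ‖u‖ := by
    have h1 : ‖(adjoint V : H →L[ℂ] H)‖ ≤ 1 := by
      rw [LinearIsometryEquiv.norm_map]
      refine ContinuousLinearMap.opNorm_le_bound _ zero_le_one fun x => ?_
      rw [one_mul, (AddMonoidHomClass.isometry_iff_norm V).1 hV x]
    simpa using (adjoint V : H →L[ℂ] H).le_of_opNorm_le h1 u
  have hu0 : u = 0 := by
    by_contra hne
    have hpos : 0 < ‖u‖ := norm_pos_iff.2 hne
    have h1 : ‖u‖ ≤ ‖c‖ * ‖u‖ := by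
      calc ‖u‖ = ‖c • adjoint V u‖ := by rw [← hu]
        _ = ‖c‖ * ‖adjoint V u‖ := norm_smul _ _
        _ ≤ ‖c‖ * ‖u‖ := by gcongr
    nlinarith
  exact Subtype.ext (by simp [hu0])

-- Against an eigenvector of `T*`, the operator `T` acts as the scalar `b`, leaving a polynomial in
-- `S` alone.
open Polynomial in
theorem inner_polyEval_eq_inner_aeval_slice {S T : H →L[ℂ] H} (hST : Commute S T) {b : ℂ} {v : H}
    (hv : v ∈ LinearMap.ker (adjoint (T - b • (1 : H →L[ℂ] H)) : H →L[ℂ] H).toLinearMap)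
    (q : Poly) (x : H) :
    inner ℂ v (polyEval S T q x) = inner ℂ v (aeval S (slice q b) x) := by
  induction q using MvPolynomial.induction_on generalizing x with
  | C c =>
    rw [polyEval_C, slice, bivariate_C]
    simp [Algebra.algebraMap_eq_smul_one]
  | add p q hp hq =>
    rw [map_add, slice, map_add, Polynomial.map_add, map_add, add_apply,
      add_apply, inner_add_right, inner_add_right, hp, hq]
    rfl
  | mul_X p i hp =>
    fin_cases i
    · rw [Fin.zero_eta, polyEval_mul hST, polyEval_X_zero, slice, map_mul, bivariate_X_zero,
        Polynomial.map_mul, map_mul, map_X, aeval_X]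
      exact hp (S x)
    · rw [Fin.mk_one, mul_comm, polyEval_mul hST, polyEval_X_one, slice, map_mul, bivariate_X_one,
        Polynomial.map_mul, map_C, map_mul, aeval_C]
      change inner ℂ v (T (polyEval S T p x)) = _
      rw [mem_ker_adjoint_sub.1 hv, hp]
      simp [Algebra.algebraMap_eq_smul_one, slice]

theorem inner_polyEval_of_mem_jointKer {S T : H →L[ℂ] H} (hST : Commute S T) {a b : ℂ} {v : H}
    (hv : v ∈ jointKer S T (a, b)) (q : Poly) (x : H) :
    inner ℂ v (polyEval S T q x) = MvPolynomial.eval ![a, b] q * inner ℂ v x := by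
  obtain ⟨ha, hb⟩ := hv
  replace ha := mem_ker_adjoint_sub.1 ha
  replace hb := mem_ker_adjoint_sub.1 hb
  induction q using MvPolynomial.induction_on generalizing x with
  | C c => rw [polyEval_C]; simp
  | add p q hp hq =>
    rw [map_add, add_apply, inner_add_right, hp, hq, map_add, add_mul]
  | mul_X p i hp =>
    rw [polyEval_mul hST]
    fin_cases i
    · rw [Fin.zero_eta, polyEval_X_zero]
      change inner ℂ v (polyEval S T p (S x)) = _
      rw [hp, ha, map_mul, MvPolynomial.eval_X, mul_assoc]
      rfl
    · rw [Fin.mk_one, polyEval_X_one]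
      change inner ℂ v (polyEval S T p (T x)) = _
      rw [hp, hb, map_mul, MvPolynomial.eval_X, mul_assoc]
      rfl

-- Peel off one linear factor at a time: by rank-nullity inside the invariant `E`, each contributes
-- at most `r`.
open Polynomial in
theorem rank_ker_adjoint_aeval_inf_le {S : H →L[ℂ] H} {E : Submodule ℂ H}
    (hE : ∀ (c : ℂ), ∀ v ∈ E, adjoint (S - c • (1 : H →L[ℂ] H)) v ∈ E) {r : ℕ} (s : Multiset ℂ)
    (hs : ∀ c ∈ s, Module.rank ℂ ↥(LinearMap.ker
      (adjoint (S - c • (1 : H →L[ℂ] H)) : H →L[ℂ] H).toLinearMap ⊓ E) ≤ r) :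
    Module.rank ℂ ↥(LinearMap.ker
      (adjoint (aeval S (s.map fun c => X - C c).prod) : H →L[ℂ] H).toLinearMap ⊓ E) ≤
        (Multiset.card s * r : ℕ) := by
  induction s using Multiset.induction_on with
  | empty =>
    have : LinearMap.ker (adjoint (aeval S ((0 : Multiset ℂ).map fun c => X - C c).prod) :
        H →L[ℂ] H).toLinearMap ⊓ E = ⊥ := by
      rw [eq_bot_iff]
      rintro v ⟨hv, -⟩
      refine (inner_self_eq_zero (𝕜 := ℂ)).1 ?_
      simpa using mem_ker_adjoint.1 hv v
    rw [this]
    simp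
  | cons c s ih =>
    have hc : aeval S ((c ::ₘ s).map fun c => X - C c).prod
        = (S - c • (1 : H →L[ℂ] H)) ∘L aeval S (s.map fun c => X - C c).prod := by
      rw [Multiset.map_cons, Multiset.prod_cons, map_mul, map_sub, aeval_X, aeval_C,
        Algebra.algebraMap_eq_smul_one]
      rfl
    rw [hc, adjoint_comp]
    refine (rank_ker_comp_inf_le (adjoint (S - c • (1 : H →L[ℂ] H))).toLinearMap _ E
      (hE c)).trans ?_
    refine (add_le_add (hs c (Multiset.mem_cons_self c s))
      (ih fun a ha => hs a (Multiset.mem_cons_of_mem ha))).trans ?_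
    rw [Multiset.card_cons, add_mul, one_mul, add_comm, Nat.cast_add]

end

end Isopair

/-! ### Rank against near cyclicity. -/

namespace Isopair

open ContinuousLinearMap Cardinal

noncomputable section

variable {H : Type*} [NormedAddCommGroup H] [InnerProductSpace ℂ H]

open Polynomial in
theorem exists_aeval_eq_zero_of_finiteDimensional (A : H →L[ℂ] H) (F : Submodule ℂ H)
    [FiniteDimensional ℂ F] (hF : ∀ v ∈ F, A v ∈ F) :
    ∃ q : ℂ[X], q ≠ 0 ∧ ∀ v ∈ F, aeval A q v = 0 := by
  let f : Module.End ℂ F := A.toLinearMap.restrict hF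
  have hpow : ∀ (n : ℕ) (v : F), (((f ^ n) v : F) : H) = (A ^ n) v := by
    intro n
    induction n with
    | zero => intro v; rfl
    | succ n ih =>
      intro v
      rw [pow_succ, pow_succ]
      exact ih (f v)
  have hf : ∀ (q : ℂ[X]) (v : F), ((aeval f q v : F) : H) = aeval A q v := by
    intro q v
    induction q using Polynomial.induction_on' with
    | add p q hp hq =>
      rw [map_add, map_add, LinearMap.add_apply, add_apply, Submodule.coe_add, hp, hq]
    | monomial n c =>
      rw [aeval_monomial, aeval_monomial, ← Algebra.smul_def, ← Algebra.smul_def]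
      change ((c • (f ^ n) v : F) : H) = c • (A ^ n) v
      rw [Submodule.coe_smul, hpow]
  refine ⟨minpoly ℂ f, minpoly.ne_zero (Algebra.IsIntegral.isIntegral f), fun v hv => ?_⟩
  rw [← hf _ ⟨v, hv⟩, minpoly.aeval]
  rfl

open Polynomial in
theorem aeval_apply_of_eigenvector {A : H →L[ℂ] H} {c : ℂ} {v : H} (h : A v = c • v) (q : ℂ[X]) :
    aeval A q v = q.eval c • v := by
  obtain ⟨r, hr⟩ := X_sub_C_dvd_sub_C_eval (a := c) (p := q)
  have hq : q = r * (X - C c) + C (q.eval c) := by rw [mul_comm, ← hr]; ring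
  conv_lhs => rw [hq]
  rw [map_add, map_mul, map_sub, aeval_X, aeval_C, aeval_C, Algebra.algebraMap_eq_smul_one,
    Algebra.algebraMap_eq_smul_one]
  change aeval A r (A v - c • v) + q.eval c • v = _
  rw [h, sub_self, map_zero, zero_add]

theorem polyEval_apply_mem_polySpan {S T : H →L[ℂ] H} (hST : Commute S T) {k : ℕ} {f : Fin k → H}
    (q : Poly) {x : H} (hx : x ∈ polySpan S T f) : polyEval S T q x ∈ polySpan S T f := by
  obtain ⟨r, rfl⟩ := hx
  rw [map_sum]
  refine sum_mem fun j _ => ?_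
  have := polyEval_mem_polySpan S T f (q * r j) j
  rwa [polyEval_mul hST] at this

open Polynomial in
theorem polyEval_bivariate_symm_C {S T : H →L[ℂ] H} (hST : Commute S T) (d : ℂ[X]) :
    polyEval S T (bivariate.symm (C d)) = aeval T d := by
  rw [← bivariate_aeval_X_one, AlgEquiv.symm_apply_apply, ← polyEvalHom_apply hST,
    ← aeval_algHom_apply, polyEvalHom_apply, polyEval_X_one]

open Polynomial in
theorem polyEval_bivariate_symm_X (S T : H →L[ℂ] H) :
    polyEval S T (bivariate.symm X) = S := by
  rw [← bivariate_X_zero, AlgEquiv.symm_apply_apply, polyEval_X_zero]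

theorem HasNearlyCyclicVectors.of_directSum {ι : Type*} [Fintype ι] {K : ι → Type*}
    [∀ j, NormedAddCommGroup (K j)] [∀ j, InnerProductSpace ℂ (K j)] {S T : ∀ j, K j →L[ℂ] K j}
    {l : ℕ} (h : HasNearlyCyclicVectors (directSum S) (directSum T) l) (j : ι) :
    HasNearlyCyclicVectors (S j) (T j) l := by
  classical
  obtain ⟨f, hf⟩ := h
  refine ⟨fun i => f i j, ?_⟩
  set W := (polySpan (S j) (T j) fun i => f i j).topologicalClosure with hW
  let π : PiLp 2 K →L[ℂ] K j := PiLp.proj 2 K j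
  have hle : (polySpan (directSum S) (directSum T) f).topologicalClosure
      ≤ W.comap π.toLinearMap := by
    refine Submodule.topologicalClosure_minimal _ ?_
      ((Submodule.isClosed_topologicalClosure _).preimage π.continuous)
    rw [polySpan_le]
    intro q i
    change polyEval (directSum S) (directSum T) q (f i) j ∈ W
    rw [polyEval_directSum_apply]
    exact Submodule.le_topologicalClosure _
      (polyEval_mem_polySpan (S j) (T j) (fun i => f i j) q i)
  refine Module.Finite.of_surjective (Submodule.mapQ _ W π.toLinearMap hle) ?_
  rw [← LinearMap.range_eq_top, Submodule.range_mapQ, LinearMap.range_eq_top.2, Submodule.map_top,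
    Submodule.range_mkQ]
  intro v
  exact ⟨inclusion K j v, by simp [π, inclusion_apply]⟩

variable [CompleteSpace H]

open Polynomial in
/-- Over a generic point of the disk the defect space decomposes into joint eigenspaces. -/
theorem mult_le_of_hasRank {p : Poly} (hirr : Irreducible p) (hp : IsInnerToral p)
    {S T : H →L[ℂ] H} (h : IsPureIsopair p S T) {r : ℕ} (hr : HasRank p S T r) :
    mult T ≤ ((bivariate p).natDegree * r : ℕ) := by
  obtain ⟨b, hb, -, hdeg, hreg⟩ := hp.exists_regular_slice hirr Set.finite_empty
  refine (mult_le_rank_ker_adjoint_sub h.pure_right.1 hb).trans ?_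
  set E := LinearMap.ker (adjoint (T - b • (1 : H →L[ℂ] H)) : H →L[ℂ] H).toLinearMap with hE
  have hinv : ∀ (c : ℂ), ∀ v ∈ E, adjoint (S - c • (1 : H →L[ℂ] H)) v ∈ E := by
    intro c v hv
    rw [hE, mem_ker_adjoint_sub] at hv ⊢
    intro x
    rw [adjoint_inner_left, adjoint_inner_left, ← hv]
    congr 1
    have hc : Commute (S - c • (1 : H →L[ℂ] H)) T :=
      h.commute.sub_left ((Commute.one_left T).smul_left c)
    exact congrArg (fun A : H →L[ℂ] H => A x) hc.eq
  have hs0 : slice p b ≠ 0 := by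
    intro h0
    rw [h0, natDegree_zero] at hdeg
    exact (hp.natDegree_bivariate_pos hirr).ne hdeg
  have hsplit : (slice p b).Splits := IsAlgClosed.splits _
  -- The eigenspace over a root `c` inside `E` is the joint eigenspace at the regular point `(c,
  -- b)`, of dimension `r`.
  have hmain := rank_ker_adjoint_aeval_inf_le hinv (r := r) (slice p b).roots fun c hc => by
    obtain ⟨h1, h2⟩ := hreg c ((mem_roots hs0).1 hc)
    exact (hr _ h1 h2).le
  rw [← hsplit.natDegree_eq_card_roots, hdeg] at hmain
  suffices hle : E ≤ LinearMap.ker (adjoint (aeval S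
      ((slice p b).roots.map fun c => X - C c).prod) : H →L[ℂ] H).toLinearMap by
    rwa [inf_eq_right.2 hle] at hmain
  intro v hv
  rw [mem_ker_adjoint]
  intro x
  have h1 := inner_polyEval_eq_inner_aeval_slice h.commute hv p x
  rw [h.annihilates, hsplit.eq_prod_roots, map_mul, aeval_C,
    Algebra.algebraMap_eq_smul_one] at h1
  change inner ℂ v (0 : H) = inner ℂ v ((slice p b).leadingCoeff • aeval S _ x) at h1
  rw [inner_zero_right, inner_smul_right, eq_comm, mul_eq_zero] at h1
  exact h1.resolve_left (leadingCoeff_ne_zero.2 hs0)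

open Polynomial in
/-- The shift of the defect space of `T` by `S` is rational over `T`. -/
theorem exists_aeval_apply_apply_mem {S T : H →L[ℂ] H} (hST : Commute S T) (hS : Isometry S)
    (hT : Isometry T) (hfin : mult S < ℵ₀) {L : Submodule ℂ H}
    (hL : ∀ v, adjoint T v = 0 → v ∈ L) (hTL : ∀ v ∈ L, T v ∈ L) {v : H} (hv : adjoint T v = 0) :
    ∃ d : ℂ[X], d ≠ 0 ∧ aeval T d (S v) ∈ L := by
  have hadj : ∀ x, adjoint S (adjoint T x) = adjoint T (adjoint S x) := by
    intro x
    have h1 : adjoint (T ∘L S) = adjoint (S ∘L T) := congrArg _ hST.symm.eq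
    rw [adjoint_comp, adjoint_comp] at h1
    exact congrArg (fun A : H →L[ℂ] H => A x) h1
  have hF : FiniteDimensional ℂ (LinearMap.ker (adjoint S : H →L[ℂ] H).toLinearMap) :=
    Module.rank_lt_aleph0_iff.1 hfin
  obtain ⟨q, q0, hq⟩ := exists_aeval_eq_zero_of_finiteDimensional (adjoint T : H →L[ℂ] H)
    (LinearMap.ker (adjoint S : H →L[ℂ] H).toLinearMap) (by
      intro x hx
      change adjoint S (adjoint T x) = 0
      rw [hadj, show adjoint S x = 0 from hx, map_zero])
  -- The extra factor `X` moves `S v` into the finite dimensional `ker S*`: indeed `S* T* S v = T*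
  -- S* S v = T* v = 0`. There `q(T*)` vanishes.
  refine exists_aeval_apply_mem hT hL hTL (mul_ne_zero q0 X_ne_zero) ?_
  rw [map_mul, aeval_X]
  refine hq (adjoint T (S v)) ?_
  change adjoint S (adjoint T (S v)) = 0
  rw [hadj, adjoint_apply_apply_of_isometry hS, hv]

open Polynomial in
/-- An isopair of rank `r` is generated by `r` vectors up to finite codimension. -/
theorem hasNearlyCyclicVectors_of_hasRank {p : Poly} (hirr : Irreducible p) (hp : IsInnerToral p)
    {S T : H →L[ℂ] H} (h : IsPureIsopair p S T) (hfin : FiniteBimultiplicity S T) {r : ℕ}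
    (hr : HasRank p S T r) : HasNearlyCyclicVectors S T r := by
  have hST := h.commute
  set E := LinearMap.ker (adjoint T : H →L[ℂ] H).toLinearMap with hE
  have hEfin : FiniteDimensional ℂ E := Module.rank_lt_aleph0_iff.1 hfin.2
  let b := Module.finBasis ℂ E
  set M := Module.finrank ℂ E with hM
  let e : Fin M → H := fun i => b i
  have hMle : M ≤ (bivariate p).natDegree * r := by
    have h1 := mult_le_of_hasRank hirr hp h hr
    rw [mult, ← hE, ← Module.finrank_eq_rank, Nat.cast_le] at h1
    exact h1
  have hspan : ∀ v, adjoint T v = 0 → ∃ c : Fin M → ℂ, v = ∑ i, c i • e i := by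
    intro v hv
    refine ⟨fun i => b.repr ⟨v, hv⟩ i, ?_⟩
    have h1 := congrArg (Submodule.subtype E) (b.sum_repr ⟨v, hv⟩)
    rw [map_sum] at h1
    exact h1.symm
  -- `H` becomes a `ℂ[w][z]`-module with `z` acting as `S` and `w` as `T`, so the module theory
  -- applies with `D = ℂ[w]`.
  let Φ : ℂ[X][X] →+* (H →L[ℂ] H) :=
    (polyEvalHom hST : Poly →+* (H →L[ℂ] H)).comp (bivariate.symm : ℂ[X][X] →+* Poly)
  let : Module ℂ[X][X] H := Module.compHom H Φ
  let : Module ℂ[X] H := Module.compHom H (C : ℂ[X] →+* ℂ[X][X])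
  have hsmul : ∀ (q : ℂ[X][X]) (x : H), q • x = polyEval S T (bivariate.symm q) x :=
    fun _ _ => rfl
  have hsmulC : ∀ (d : ℂ[X]) (x : H), d • x = (C d : ℂ[X][X]) • x := fun _ _ => rfl
  have hsmulD : ∀ (d : ℂ[X]) (x : H), d • x = aeval T d x := by
    intro d x
    rw [hsmulC, hsmul, polyEval_bivariate_symm_C hST]
  have : IsScalarTower ℂ[X] ℂ[X][X] H := by
    refine ⟨fun d q x => ?_⟩
    rw [hsmulC, smul_smul, smul_eq_C_mul]
  let L : Submodule ℂ H :=
    { carrier := (Submodule.span ℂ[X] (Set.range e) : Set H)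
      add_mem' := fun hx hy => add_mem hx hy
      zero_mem' := zero_mem _
      smul_mem' := fun c x hx => by
        have h1 := Submodule.smul_mem (Submodule.span ℂ[X] (Set.range e)) (C c) hx
        rw [hsmulD, aeval_C, Algebra.algebraMap_eq_smul_one] at h1
        exact h1 }
  have hL : ∀ v, adjoint T v = 0 → v ∈ L := by
    intro v hv
    obtain ⟨c, rfl⟩ := hspan v hv
    exact sum_mem fun i _ => L.smul_mem _ (Submodule.subset_span (s := Set.range e) ⟨i, rfl⟩)
  have hTL : ∀ v ∈ L, T v ∈ L := by
    intro v hv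
    have h1 := Submodule.smul_mem (Submodule.span ℂ[X] (Set.range e)) X hv
    rw [hsmulD, aeval_X] at h1
    exact h1
  obtain ⟨J, hJ, g, hg, hge⟩ := exists_subset_generators (p := bivariate p) (H := H)
    ((MulEquiv.prime_iff bivariate).2 hirr.prime)
    (fun x => by rw [hsmul, AlgEquiv.symm_apply_apply, h.annihilates]; rfl) e (fun i => by
      obtain ⟨d, d0, hd⟩ := exists_aeval_apply_apply_mem hST h.pure_left.1 h.pure_right.1 hfin.1
        hL hTL (v := e i) (b i).2
      refine ⟨d, d0, ?_⟩
      rw [hsmul X, polyEval_bivariate_symm_X, hsmulD]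
      exact hd)
  -- With `n` the degree in `z`, `J.card * n ≤ M ≤ n * r`; cancel `n`.
  have hJr : J.card ≤ r := by
    have hn := hp.natDegree_bivariate_pos hirr
    refine Nat.le_of_mul_le_mul_right (hJ.trans ?_) hn
    rwa [mul_comm r]
  refine HasNearlyCyclicVectors.mono ?_ hJr
  let f : Fin J.card → H := fun i => e (J.equivFin.symm i)
  refine ⟨f, ?_⟩
  have hrel : IsRelPrime p (bivariate.symm g) := by
    rw [hirr.isRelPrime_iff_not_dvd]
    intro hd
    refine hg ?_
    have := map_dvd bivariate hd
    rwa [AlgEquiv.apply_symm_apply] at this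
  have hdense : (polySpan S T e).topologicalClosure = ⊤ := by
    refine h.pure_right.eq_top_of_forall_pow_mem (Submodule.isClosed_topologicalClosure _) ?_
    intro v hv n
    refine Submodule.le_topologicalClosure _ ?_
    obtain ⟨c, rfl⟩ := hspan v hv
    have h1 : polyEval S T (MvPolynomial.X 1 ^ n) = T ^ n := by
      rw [← polyEvalHom_apply hST, map_pow, polyEvalHom_apply, polyEval_X_one]
    rw [← h1]
    exact polyEval_apply_mem_polySpan hST _
      (sum_mem fun i _ => Submodule.smul_mem _ _ (self_mem_polySpan S T e i))
  have : FiniteDimensional ℂ (H ⧸ (polySpan S T e).topologicalClosure) := by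
    rw [hdense]
    infer_instance
  refine finiteDimensional_quotient_of_mul_mem hST hrel h.annihilates e _
    (Submodule.isClosed_topologicalClosure _) fun q i => Submodule.le_topologicalClosure _ ?_
  rw [mul_comm, polyEval_mul hST]
  refine polyEval_apply_mem_polySpan hST q ?_
  have hmem : ∀ x ∈ Submodule.span ℂ[X][X] (e '' J), x ∈ polySpan S T f := by
    intro x hx
    induction hx using Submodule.span_induction with
    | mem x hx =>
      obtain ⟨i, hi, rfl⟩ := hx
      have := self_mem_polySpan S T f (J.equivFin ⟨i, hi⟩)
      simpa [f] using this
    | zero => exact zero_mem _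
    | add x y _ _ hx hy => exact add_mem hx hy
    | smul q x _ hx => exact polyEval_apply_mem_polySpan hST _ hx
  exact hmem _ (hge i)

open Polynomial in
/-- At most finitely many joint eigenspaces meet the orthogonal complement of an invariant subspace
of finite codimension, so its generators separate the vectors of a generic joint eigenspace. -/
theorem HasRank.le_of_hasNearlyCyclicVectors {p : Poly} (hirr : Irreducible p)
    (hp : IsInnerToral p) {S T : H →L[ℂ] H} (hST : Commute S T) {r l : ℕ} (hr : HasRank p S T r)
    (h : HasNearlyCyclicVectors S T l) : r ≤ l := by
  obtain ⟨f, hf⟩ := h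
  set W := (polySpan S T f).topologicalClosure with hW
  have horth : ∀ v, v ∈ Wᗮ ↔ ∀ q j, inner ℂ v (polyEval S T q (f j)) = 0 := by
    intro v
    rw [hW, Submodule.orthogonal_closure]
    constructor
    · intro hv q j
      exact (Submodule.mem_orthogonal' _ _).1 hv _ (polyEval_mem_polySpan S T f q j)
    · intro hv
      rw [Submodule.mem_orthogonal']
      rintro _ ⟨q, rfl⟩
      rw [inner_sum]
      exact Finset.sum_eq_zero fun j _ => hv _ _
  have hfin : FiniteDimensional ℂ Wᗮ := by
    refine Module.Finite.of_injective (W.mkQ ∘ₗ Wᗮ.subtype) ?_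
    rw [← LinearMap.ker_eq_bot, LinearMap.ker_eq_bot']
    rintro ⟨v, hv⟩ h0
    have hvW : v ∈ W := (Submodule.Quotient.mk_eq_zero W).1 h0
    refine Subtype.ext ((inner_self_eq_zero (𝕜 := ℂ)).1 ?_)
    exact (Submodule.mem_orthogonal _ _).1 hv v hvW
  obtain ⟨q, q0, hq⟩ := exists_aeval_eq_zero_of_finiteDimensional (adjoint T : H →L[ℂ] H) Wᗮ (by
    intro v hv
    rw [horth] at hv ⊢
    intro q j
    rw [adjoint_inner_left]
    have := hv (MvPolynomial.X 1 * q) j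
    rwa [polyEval_mul hST, polyEval_X_one] at this)
  -- Heights to avoid: a joint eigenvector at height `b` has `T*`-eigenvalue `star b`, which must
  -- not be a root of `q`.
  have hF : (star ⁻¹' (q.rootSet ℂ) : Set ℂ).Finite :=
    (q.rootSet_finite ℂ).preimage star_injective.injOn
  obtain ⟨b, -, hbF, hdeg, hreg⟩ := hp.exists_regular_slice hirr hF
  obtain ⟨a, ha⟩ := IsAlgClosed.exists_root (slice p b) (by
    have := hp.natDegree_bivariate_pos hirr
    rw [← hdeg] at this
    exact (natDegree_pos_iff_degree_pos.1 this).ne')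
  obtain ⟨h1, h2⟩ := hreg a ha
  have hrank := hr _ h1 h2
  -- A joint eigenvector orthogonal to all `f i` is orthogonal to `W`, hence killed by `q(T*)`; the
  -- choice of `b` makes it zero.
  let φ : jointKer S T (a, b) →ₗ[ℂ] (Fin l → ℂ) :=
    LinearMap.pi fun i => (innerSL ℂ (f i)).toLinearMap ∘ₗ Submodule.subtype _
  have hφ : Function.Injective φ := by
    rw [← LinearMap.ker_eq_bot, LinearMap.ker_eq_bot']
    rintro ⟨v, hv⟩ h0
    have hvW : v ∈ Wᗮ := by
      rw [horth]
      intro q j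
      rw [inner_polyEval_of_mem_jointKer hST hv,
        inner_eq_zero_symm.1 (show inner ℂ (f j) v = 0 from congrFun h0 j), mul_zero]
    by_contra hne
    have hv0 : v ≠ 0 := fun h0 => hne (Subtype.ext h0)
    have heig : adjoint T v = star b • v := by
      refine ext_inner_right ℂ fun x => ?_
      rw [adjoint_inner_left, mem_ker_adjoint_sub.1 hv.2, inner_smul_left]
      simp
    have h3 := hq v hvW
    rw [aeval_apply_of_eigenvector heig, smul_eq_zero] at h3
    refine hbF ?_
    rw [Set.mem_preimage, mem_rootSet]
    exact ⟨q0, by simpa using h3.resolve_right hv0⟩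
  have h4 := LinearMap.lift_rank_le_of_injective φ hφ
  rw [hrank] at h4
  simpa using h4

end

end Isopair

/-! ### Assembly of the two statements. -/

theorem proposition5p2 :
    (∀ (p : Fin 2 → Isopair.Poly) (K : Fin 2 → Type*)
      [∀ j, NormedAddCommGroup (K j)] [∀ j, InnerProductSpace ℂ (K j)] [∀ j, CompleteSpace (K j)]
      (S T : ∀ j, K j →L[ℂ] K j) (β : Fin 2 → ℕ),
      IsRelPrime (p 0) (p 1) →
      (∀ j, Isopair.IsPureIsopair (p j) (S j) (T j)) →
      (∀ j, Isopair.IsCyclic (S j) (T j) (β j)) →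
      Isopair.IsAtMostNearlyCyclic (Isopair.directSum S) (Isopair.directSum T)
        (max (β 0) (β 1))) ∧
    (∀ (s : ℕ) (P : Isopair.Poly) (p : Fin s → Isopair.Poly) (K : Fin s → Type*)
      [∀ j, NormedAddCommGroup (K j)] [∀ j, InnerProductSpace ℂ (K j)] [∀ j, CompleteSpace (K j)]
      (S T : ∀ j, K j →L[ℂ] K j) (α : Fin s → ℕ),
      Squarefree P →
      Isopair.IsInnerToral P →
      P = ∏ j, p j →
      (∀ j, Irreducible (p j)) →
      (∀ j, Isopair.IsPureIsopair (p j) (S j) (T j)) →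
      (∀ j, Isopair.FiniteBimultiplicity (S j) (T j)) →
      (∀ j, Isopair.HasRank (p j) (S j) (T j) (α j)) →
      Isopair.IsNearlyCyclic (Isopair.directSum S) (Isopair.directSum T)
        (Finset.univ.sup α)) := by
  refine ⟨?_, ?_⟩
  · intro p K _ _ _ S T β hrel hV hβ
    refine Isopair.HasNearlyCyclicVectors.isAtMostNearlyCyclic
      (Isopair.hasNearlyCyclicVectors_directSum (p := p) ?_ (fun j => (hV j).commute)
        (fun j => (hV j).annihilates) ?_)
    · intro i j hij
      fin_cases i <;> fin_cases j
      · exact absurd rfl hij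
      · exact hrel
      · exact hrel.symm
      · exact absurd rfl hij
    · intro j
      refine (hβ j).1.hasNearlyCyclicVectors.mono ?_
      fin_cases j
      · exact le_max_left _ _
      · exact le_max_right _ _
  · intro s P p K _ _ _ S T α hsq htoral hP hirr hV hfin hrank
    have htor : ∀ j, Isopair.IsInnerToral (p j) := fun j =>
      htoral.of_dvd (hP ▸ Finset.dvd_prod_of_mem p (Finset.mem_univ j))
    refine ⟨Isopair.hasNearlyCyclicVectors_directSum (p := p) ?_ (fun j => (hV j).commute)
      (fun j => (hV j).annihilates) fun j =>
        (Isopair.hasNearlyCyclicVectors_of_hasRank (hirr j) (htor j) (hV j) (hfin j)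
          (hrank j)).mono (Finset.le_sup (Finset.mem_univ j)), ?_⟩
    · intro i j hij
      rw [(hirr i).isRelPrime_iff_not_dvd]
      intro hd
      -- If `p i` divided another factor `p j`, its square would divide the square free `P`.
      refine (hirr i).not_isUnit (hsq (p i) ?_)
      rw [hP, ← Finset.mul_prod_erase _ _ (Finset.mem_univ i)]
      exact mul_dvd_mul_left _
        (hd.trans (Finset.dvd_prod_of_mem p (Finset.mem_erase.2 ⟨hij.symm, Finset.mem_univ j⟩)))
    · intro l hl hcyc
      -- Some `α j` exceeds `l`, and that summand alone already obstructs. For `s = 0` the supremum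
      -- is `0` and there is no such `l`.
      obtain ⟨j, -, hj⟩ := (Finset.lt_sup_iff).1 hl
      exact absurd (Isopair.HasRank.le_of_hasNearlyCyclicVectors (hirr j) (htor j)
        (hV j).commute (hrank j) (hcyc.of_directSum j)) (not_le.2 hj)
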